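/- Let $d\in\mathbb N=\{1,2,\dots\}$, $r\in\mathbb N_0$ and $Q=[0,1]^d$. For a Banach space $X$ (over $\mathbb R$ or $\mathbb C$) let $C^r(Q,X)$ be the space of $r$ times continuously differentiable functions $f:Q\to X$ with norm $\max_{|\alpha|\le r,\,t\in Q}\|D^\alpha f(t)\|$, let $B_{C^r(Q,X)}$ be its closed unit ball, and let $S^Xf=\int_Q f(t)\,dt$. A deterministic algorithm $A$ consists of arbitrary maps $L_{i+1}:X^{i}\to Q$, $\rho_i:X^i\to\{0,1\}$, $\varphi_i:X^i\to X$ $(i\ge 0)$. At input $f$ it uses the nodes $t_{i+1}=L_{i+1}(f(t_1),\dots,f(t_i))$; its cardinality $\mathrm{card}(A,f)$ is the first $m\ge 0$ with $\rho_m(f(t_1),\dots,f(t_m))=1$ ($+\infty$ if there is none), and for this $m$ its output is $Af=\varphi_m(f(t_1),\dots,f(t_m))$. A randomized algorithm is a family $(A_\omega)_{\omega\in\Omega}$ of deterministic algorithms indexed by a probability space $(\Omega,\Sigma,\mathbb P)$. For $n\in\mathbb N$, let $\mathcal A_n^{\rm ran}$ be the class of those for which, for every $f\in B_{C^r(Q,X)}$,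 $\omega\mapsto\mathrm{card}(A_\omega,f)$ is measurable with $\mathbb E\,\mathrm{card}(A_\omega,f)\le n$, and $\omega\mapsto A_\omega f$ is $\Sigma$-to-Borel measurable and almost surely takes its values in a separable subspace of $X$. The randomized $n$-th minimal error is $$e_n^{\rm ran}(S^X,B_{C^r(Q,X)})=\inf_{(A_\omega)\in\mathcal A_n^{\rm ran}}\ \sup_{f\in B_{C^r(Q,X)}}\mathbb E\,\|S^Xf-A_\omega f\|.$$ For $1\le p\le 2$ and $n\in\mathbb N$ the equal norm type $p$ constant $\sigma_{p,n}(X)$ is the infimum of all $c>0$ such that $$\Big(\mathbb E\Big\|\sum_{i=1}^n\varepsilon_ix_i\Big\|^p\Big)^{1/p}\le c\Big(\sum_{i=1}^n\|x_i\|^p\Big)^{1/p}$$ for all $x_1,\dots,x_n\in X$ with $\|x_1\|=\dots=\|x_n\|$, where $\varepsilon_1,\dots,\varepsilon_n$ are independent random variables with $\mathbb P\{\varepsilon_i=1\}=\mathbb P\{\varepsilon_i=-1\}=1/2$. Theorem. There are constants $c_1,c_2>0$, depending only on $r$ and $d$, such that for all $1\le p\le 2$, all Banach spaces $X$ and all $n\in\mathbb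 N$ $$c_1\,n^{r/d+1-1/p}\,e_n^{\rm ran}(S^X,B_{C^r(Q,X)})\ \le\ \sigma_{p,n}(X)\ \le\ c_2\max_{1\le k\le n}k^{r/d+1-1/p}\,e_k^{\rm ran}(S^X,B_{C^r(Q,X)}).$$ -/

import Mathlib

open MeasureTheory
open scoped ENNReal

universe u v

noncomputable section

namespace BanachIntegration

/-! ### The unit cube, smooth functions and integration -/

/-- The unit cube `[0,1]^d`. -/
def cube (d : ℕ) : Set (Fin d → ℝ) := Set.Icc 0 1

/-- The partial derivative `D^α f (t)` on the cube for a multi-index `α`: the derivative of order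
`|α| = ∑ i, α i` of `f` within the cube, applied to the list of unit vectors
`e_0, …, e_0, e_1, …, e_1, …` in which `e_i` occurs `α i` times. -/
def partialDeriv {d : ℕ} {X : Type u} [NormedAddCommGroup X] [NormedSpace ℝ X]
    (α : Fin d → ℕ) (f : (Fin d → ℝ) → X) (t : Fin d → ℝ) : X :=
  iteratedFDerivWithin ℝ (∑ i, α i) f (cube d) t
    (fun j => Pi.single (finSigmaFinEquiv.symm j).1 (1 : ℝ))

/-- The `C^r` norm on the cube: the supremum of `‖D^α f (t)‖` over `|α| ≤ r` and `t` in the cube. -/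
def crNorm {d : ℕ} {X : Type u} [NormedAddCommGroup X] [NormedSpace ℝ X]
    (r : ℕ) (f : (Fin d → ℝ) → X) : ℝ≥0∞ :=
  ⨆ (α : Fin d → ℕ) (_ : ∑ i, α i ≤ r) (t : Fin d → ℝ) (_ : t ∈ cube d), ‖partialDeriv α f t‖ₑ

/-- The closed unit ball of `C^r([0,1]^d, X)`. Functions are represented by arbitrary extensions to
`ℝ^d`; everything below depends on their values on the cube only. -/
def crBall (d r : ℕ) (X : Type u) [NormedAddCommGroup X] [NormedSpace ℝ X] :
    Set ((Fin d → ℝ) → X) :=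
  {f | ContDiffOn ℝ (r : ℕ) f (cube d) ∧ crNorm r f ≤ 1}

/-- The integration operator `S f = ∫ f(t) dt` over the cube. -/
def cubeIntegral {d : ℕ} {X : Type u} [NormedAddCommGroup X] [NormedSpace ℝ X]
    (f : (Fin d → ℝ) → X) : X :=
  ∫ t in cube d, f t

/-! ### Deterministic algorithms -/

/-- A deterministic adaptive algorithm of varying cardinality. After `i` function values have been
observed, `halt i` says whether the algorithm halts; if so, `out i` is its output, and otherwise
`next i` is the node of the next evaluation. (For `i = 0` these are constants.) -/
structure DetAlg (d : ℕ) (X : Type u) where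
  next : ∀ i : ℕ, (Fin i → X) → cube d
  halt : ∀ i : ℕ, (Fin i → X) → Bool
  out : ∀ i : ℕ, (Fin i → X) → X

namespace DetAlg

variable {d : ℕ} {X : Type u}

/-- The first `i` values `f(t_1), …, f(t_i)`, where `t_{j+1} = next j (f(t_1), …, f(t_j))`. -/
def info (A : DetAlg d X) (f : (Fin d → ℝ) → X) : ∀ i : ℕ, Fin i → X
  | 0 => Fin.elim0
  | i + 1 => Fin.snoc (α := fun _ => X) (info A f i) (f (A.next i (info A f i)))

/-- The algorithm halts at input `f`. -/
abbrev Halts (A : DetAlg d X) (f : (Fin d → ℝ) → X) : Prop :=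
  ∃ i : ℕ, A.halt i (A.info f i) = true

open Classical in
/-- The cardinality of the algorithm at input `f`: the number of values of `f` that are used before
it halts, and `∞` if it does not halt. -/
def card (A : DetAlg d X) (f : (Fin d → ℝ) → X) : ℕ∞ :=
  if h : A.Halts f then ((Nat.find h : ℕ) : ℕ∞) else ⊤

open Classical in
/-- The output of the algorithm at input `f`; it has no output if it does not halt, and the
value `0` is then used as a placeholder. -/
def output [Zero X] (A : DetAlg d X) (f : (Fin d → ℝ) → X) : X :=
  if h : A.Halts f then A.out (Nat.find h) (A.info f (Nat.find h)) else 0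

end DetAlg

/-! ### Randomized algorithms and minimal errors -/

/-- A randomized algorithm: a family of deterministic ones indexed by a probability space. -/
structure RanAlg (d : ℕ) (X : Type u) where
  Ω : Type v
  mΩ : MeasurableSpace Ω
  P : Measure Ω
  isProb : IsProbabilityMeasure P
  alg : Ω → DetAlg d X

namespace RanAlg

variable {d : ℕ} {X : Type u} [NormedAddCommGroup X] [NormedSpace ℝ X]

/-- The algorithm belongs to the class of those that use, on every input from the unit ball
of `C^r`, at most `n` function values on the average, with cardinality and output measurable and the
output essentially separably valued. -/
def Admissible (A : RanAlg.{u, v} d X) (r n : ℕ) : Prop :=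
  letI := A.mΩ
  ∀ f ∈ crBall d r X,
    Measurable (fun ω => (A.alg ω).card f) ∧
    ∫⁻ ω, (((A.alg ω).card f : ℕ∞) : ℝ≥0∞) ∂A.P ≤ (n : ℝ≥0∞) ∧
    Measurable[A.mΩ, borel X] (fun ω => (A.alg ω).output f) ∧
    ∃ X₀ : Submodule ℝ X, TopologicalSpace.IsSeparable (X₀ : Set X) ∧
      ∀ᵐ ω ∂A.P, (A.alg ω).output f ∈ X₀

/-- The error of the algorithm: the supremum over `f` in the unit ball of `C^r` of the
expectation of `‖S f - A_ω f‖`. -/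
def error (A : RanAlg.{u, v} d X) (r : ℕ) : ℝ≥0∞ :=
  letI := A.mΩ
  ⨆ f ∈ crBall d r X, ∫⁻ ω, ‖cubeIntegral f - (A.alg ω).output f‖ₑ ∂A.P

end RanAlg

/-- The randomized `n`-th minimal error of integration on the unit ball of `C^r([0,1]^d, X)`. -/
def ranMinError (d r : ℕ) (X : Type u) [NormedAddCommGroup X] [NormedSpace ℝ X] (n : ℕ) : ℝ≥0∞ :=
  ⨅ (A : RanAlg.{u, v} d X) (_ : A.Admissible r n), A.error r

/-! ### Equal norm type `p` constants -/

/-- `(𝔼 ‖∑ ε_i x_i‖^p)^(1/p)` for independent signs `ε_i`, each `±1` with probability `1/2`; that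
is, `ε` is uniformly distributed on the `2^n` choices of signs. -/
def rademacherNorm {X : Type u} [NormedAddCommGroup X] (p : ℝ) {n : ℕ} (x : Fin n → X) : ℝ :=
  ((∑ ε : Fin n → ℤˣ, ‖∑ i, (ε i : ℤ) • x i‖ ^ p) / 2 ^ n) ^ (1 / p)

/-- The equal norm type `p` constant `σ_{p,n}(X)`: the infimum of all `c > 0` such that
`(𝔼 ‖∑ ε_i x_i‖^p)^(1/p) ≤ c (∑ ‖x_i‖^p)^(1/p)` for all `x_1, …, x_n` of equal norm. -/
def equalNormTypeConst (p : ℝ) (n : ℕ) (X : Type u) [NormedAddCommGroup X] : ℝ :=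
  sInf {c : ℝ | 0 < c ∧ ∀ x : Fin n → X, (∀ i j, ‖x i‖ = ‖x j‖) →
    rademacherNorm p x ≤ c * (∑ i, ‖x i‖ ^ p) ^ (1 / p)}

end BanachIntegration

end

/-!
Both inequalities compare integration errors with Rademacher averages `𝔼 ‖∑ ε_i x_i‖` of vectors in
a ball. By Kahane's inequality and the contraction principle, these are controlled by `σ_{p,n}` and
control it, whatever the exponent and whether the norms are equal or only bounded.

**Upper bound for the errors.** About half of the `n` values are spent on a grid. They determine
some function `g` of the unit ball with the same grid values as `f`; the output is the integral
of `g` plus the Monte Carlo estimate for the integral of `f - g` with the remaining values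
(`controlVariate`). The function `f - g` vanishes on the grid, hence it is of the order `n ^ (-r/d)`
(`exists_norm_le_of_vanishing_on_grid`, by the mean value theorem in each coordinate). By
symmetrization, the Monte Carlo error is at most twice a Rademacher average over values of `f - g`,
divided by the number of samples (`lintegral_monteCarlo_le`).

**Lower bound for the errors.** Put bumps with disjoint supports, multiplied by signed vectors
`ε_i x_i`, into `N ≥ 8 k` cells. An algorithm that uses about `k` values sees only few of the signs,
and the others may still be randomized without changing its output (`sum_radMean_le_sum_error`). So
the error is at least of the order `N ^ (-r/d - 1)` times the Rademacher average over some half of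
the vectors (`exists_subset_radMean_le`). Splitting off such halves repeatedly, one bounds the
Rademacher average over all `n` vectors by a geometric sum (`radMean_le_of_halving`), which is where
the errors with all `k ≤ n` enter.

**Kahane's inequality** is proved with the argument of Latała and Oleszkiewicz: the norm of a
Rademacher sum is an even function on the discrete cube, for which the spectral gap is `2`, and its
Dirichlet form is at most its second moment (`signMean_sq_le`).
-/

noncomputable section

namespace BanachIntegration

/-! ### Averages over signs -/

section SignMean

variable {n : ℕ}

/-- The mean of a function of uniformly distributed signs indexed by `Fin n`. -/
def signMean (F : (Fin n → ℤˣ) → ℝ) : ℝ := (∑ ε, F ε) / 2 ^ n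

lemma signMean_add (F G : (Fin n → ℤˣ) → ℝ) :
    signMean (fun ε => F ε + G ε) = signMean F + signMean G := by
  simp only [signMean, Finset.sum_add_distrib, add_div]

lemma signMean_sub (F G : (Fin n → ℤˣ) → ℝ) :
    signMean (fun ε => F ε - G ε) = signMean F - signMean G := by
  simp only [signMean, Finset.sum_sub_distrib, sub_div]

lemma signMean_const_mul (c : ℝ) (F : (Fin n → ℤˣ) → ℝ) :
    signMean (fun ε => c * F ε) = c * signMean F := by
  simp only [signMean, ← Finset.mul_sum, mul_div_assoc]

lemma signMean_const (c : ℝ) : signMean (fun _ : Fin n → ℤˣ => c) = c := by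
  simp [signMean]

lemma signMean_sum {κ : Type*} (s : Finset κ) (F : κ → (Fin n → ℤˣ) → ℝ) :
    signMean (fun ε => ∑ k ∈ s, F k ε) = ∑ k ∈ s, signMean (F k) := by
  simp only [signMean]
  rw [Finset.sum_comm, Finset.sum_div]

lemma signMean_mono {F G : (Fin n → ℤˣ) → ℝ} (h : ∀ ε, F ε ≤ G ε) : signMean F ≤ signMean G := by
  unfold signMean
  gcongr with ε
  exact h ε

lemma signMean_nonneg {F : (Fin n → ℤˣ) → ℝ} (h : ∀ ε, 0 ≤ F ε) : 0 ≤ signMean F := by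
  unfold signMean
  have := Finset.sum_nonneg fun ε (_ : ε ∈ Finset.univ) => h ε
  positivity

lemma signMean_comp_perm (e : Equiv.Perm (Fin n → ℤˣ)) (F : (Fin n → ℤˣ) → ℝ) :
    signMean (fun ε => F (e ε)) = signMean F := by
  unfold signMean
  rw [Equiv.sum_comp e F]

lemma signMean_comp_mul_left (η : Fin n → ℤˣ) (F : (Fin n → ℤˣ) → ℝ) :
    signMean (fun ε => F (η * ε)) = signMean F :=
  signMean_comp_perm (Equiv.mulLeft η) F

/-- Jensen's inequality for powers of a nonnegative function of the signs. -/
lemma signMean_le_rpow {F : (Fin n → ℤˣ) → ℝ} (h : ∀ ε, 0 ≤ F ε) {p : ℝ} (hp : 1 ≤ p) :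
    signMean F ≤ (signMean fun ε => F ε ^ p) ^ (1 / p) := by
  have := Real.arith_mean_le_rpow_mean (Finset.univ : Finset (Fin n → ℤˣ))
    (fun _ => 1 / 2 ^ n) F (fun _ _ => by positivity) (by simp)
    (fun ε _ => h ε) hp
  rw [← Finset.mul_sum, ← Finset.mul_sum] at this
  unfold signMean
  convert this using 2 <;> ring

/-- Monotonicity of the `L_p` norms of a nonnegative function of the signs, for exponents `≤ 2`. -/
lemma signMean_rpow_le_sq {F : (Fin n → ℤˣ) → ℝ} (h : ∀ ε, 0 ≤ F ε) {p : ℝ} (hp : 1 ≤ p)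
    (hp2 : p ≤ 2) :
    (signMean fun ε => F ε ^ p) ^ (1 / p) ≤ (signMean fun ε => F ε ^ 2) ^ ((1 : ℝ) / 2) := by
  have hp0 : 0 < p := by linarith
  have h0 : 0 ≤ signMean fun ε => F ε ^ p := signMean_nonneg fun ε => Real.rpow_nonneg (h ε) _
  have h1 := signMean_le_rpow (F := fun ε => F ε ^ p) (fun ε => Real.rpow_nonneg (h ε) _)
    (p := 2 / p) (by rwa [le_div_iff₀ hp0, one_mul])
  have h2 : ∀ ε, (F ε ^ p) ^ (2 / p) = F ε ^ 2 := fun ε => by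
    rw [← Real.rpow_mul (h ε), mul_div_cancel₀ _ hp0.ne', Real.rpow_two]
  simp only [h2] at h1
  have h3 : 0 ≤ signMean fun ε => F ε ^ 2 := signMean_nonneg fun ε => sq_nonneg _
  calc _ ≤ ((signMean fun ε => F ε ^ 2) ^ (1 / (2 / p))) ^ (1 / p) := by gcongr
    _ = _ := by
      rw [← Real.rpow_mul h3]
      congr 1
      field_simp

/-- Changing the sign of one coordinate. -/
def flipSign (i : Fin n) (ε : Fin n → ℤˣ) : Fin n → ℤˣ := Function.update ε i (-ε i)

lemma flipSign_involutive (i : Fin n) :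
    Function.Involutive (flipSign i : (Fin n → ℤˣ) → Fin n → ℤˣ) := by
  intro ε
  simp [flipSign]

lemma signMean_comp_flipSign (i : Fin n) (F : (Fin n → ℤˣ) → ℝ) :
    signMean (fun ε => F (flipSign i ε)) = signMean F :=
  signMean_comp_perm (flipSign_involutive i).toPerm F

/-- The Dirichlet form of the discrete cube. -/
def signEnergy (F : (Fin n → ℤˣ) → ℝ) : ℝ :=
  ∑ i, signMean fun ε => ((F ε - F (flipSign i ε)) / 2) ^ 2

/-- The total weight of a function of signs on the first level of its Walsh expansion. -/
def levelOneWeight (F : (Fin n → ℤˣ) → ℝ) : ℝ :=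
  ∑ i, (signMean fun ε => ((ε i : ℤ) : ℝ) * F ε) ^ 2

end SignMean

section Poincare

variable {n : ℕ}

lemma signMean_cons (F : (Fin (n + 1) → ℤˣ) → ℝ) :
    signMean F = (signMean (fun η : Fin n → ℤˣ => F (Fin.cons 1 η)) +
      signMean (fun η : Fin n → ℤˣ => F (Fin.cons (-1) η))) / 2 := by
  unfold signMean
  rw [← Equiv.sum_comp (Fin.consEquiv (fun _ => ℤˣ)) F, Fintype.sum_prod_type,
    show (Finset.univ : Finset ℤˣ) = {1, -1} from rfl, Finset.sum_pair (by decide)]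
  simp only [pow_succ]
  field_simp
  rfl

lemma flipSign_zero_cons (s : ℤˣ) (η : Fin n → ℤˣ) :
    flipSign 0 (Fin.cons s η : Fin (n + 1) → ℤˣ) = Fin.cons (-s) η := by
  simp [flipSign]

lemma flipSign_succ_cons (i : Fin n) (s : ℤˣ) (η : Fin n → ℤˣ) :
    flipSign i.succ (Fin.cons s η : Fin (n + 1) → ℤˣ) = Fin.cons s (flipSign i η) := by
  simp [flipSign, Fin.cons_update]

/-- The part of a function of `n + 1` signs that is even in the first one. -/
def consEven (F : (Fin (n + 1) → ℤˣ) → ℝ) (η : Fin n → ℤˣ) : ℝ :=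
  (F (Fin.cons 1 η) + F (Fin.cons (-1) η)) / 2

/-- The coefficient of the first sign in a function of `n + 1` signs. -/
def consOdd (F : (Fin (n + 1) → ℤˣ) → ℝ) (η : Fin n → ℤˣ) : ℝ :=
  (F (Fin.cons 1 η) - F (Fin.cons (-1) η)) / 2

lemma signMean_half_add (F G : (Fin n → ℤˣ) → ℝ) :
    (signMean F + signMean G) / 2 = signMean fun η => (F η + G η) / 2 := by
  simp only [signMean, ← Finset.sum_div, Finset.sum_add_distrib]
  ring

lemma signMean_eq_consEven (F : (Fin (n + 1) → ℤˣ) → ℝ) :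
    signMean F = signMean (consEven F) := by
  rw [signMean_cons, signMean_half_add]
  rfl

lemma signMean_sq_cons (F : (Fin (n + 1) → ℤˣ) → ℝ) :
    signMean (fun ε => F ε ^ 2) =
      signMean (fun η => consEven F η ^ 2) + signMean (fun η => consOdd F η ^ 2) := by
  rw [signMean_cons, signMean_half_add, ← signMean_add]
  congr 1
  ext η
  simp only [consEven, consOdd]
  ring

lemma signEnergy_cons (F : (Fin (n + 1) → ℤˣ) → ℝ) :
    signEnergy F = signMean (fun η => consOdd F η ^ 2) + signEnergy (consEven F) +
      signEnergy (consOdd F) := by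
  unfold signEnergy
  rw [Fin.sum_univ_succ, add_assoc, ← Finset.sum_add_distrib]
  congr 1
  · rw [signMean_cons, signMean_half_add]
    congr 1
    ext η
    simp only [flipSign_zero_cons, consOdd, neg_neg]
    ring
  · refine Finset.sum_congr rfl fun i _ => ?_
    rw [signMean_cons, signMean_half_add, ← signMean_add]
    congr 1
    ext η
    simp only [flipSign_succ_cons, consOdd, consEven]
    ring

lemma levelOneWeight_cons (F : (Fin (n + 1) → ℤˣ) → ℝ) :
    levelOneWeight F = signMean (consOdd F) ^ 2 + levelOneWeight (consEven F) := by
  unfold levelOneWeight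
  rw [Fin.sum_univ_succ]
  congr 1
  · rw [signMean_cons, signMean_half_add]
    congr 2
    ext η
    simp only [Fin.cons_zero, consOdd]
    push_cast
    ring
  · refine Finset.sum_congr rfl fun i _ => ?_
    rw [signMean_cons, signMean_half_add]
    congr 2
    ext η
    simp only [Fin.cons_succ, consEven]
    ring

/-- The Poincaré inequality on the discrete cube. -/
lemma signVariance_le_energy : ∀ {n : ℕ} (F : (Fin n → ℤˣ) → ℝ),
    signMean (fun ε => F ε ^ 2) - signMean F ^ 2 ≤ signEnergy F
  | 0, F => by simp [signMean, signEnergy]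
  | n + 1, F => by
    have h1 := signVariance_le_energy (consEven F)
    have h2 : 0 ≤ signEnergy (consOdd F) :=
      Finset.sum_nonneg fun i _ => signMean_nonneg fun ε => sq_nonneg _
    rw [signMean_sq_cons, signEnergy_cons, signMean_eq_consEven]
    linarith

/-- The Poincaré inequality on the discrete cube has constant `1/2` apart from the contribution of
the first level, since the remaining nonconstant Walsh functions have eigenvalues `≥ 2`. -/
lemma two_mul_signVariance_le : ∀ {n : ℕ} (F : (Fin n → ℤˣ) → ℝ),
    2 * (signMean (fun ε => F ε ^ 2) - signMean F ^ 2) - levelOneWeight F ≤ signEnergy F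
  | 0, F => by simp [signMean, signEnergy, levelOneWeight]
  | n + 1, F => by
    have h1 := two_mul_signVariance_le (consEven F)
    have h2 := signVariance_le_energy (consOdd F)
    rw [signMean_sq_cons, signEnergy_cons, signMean_eq_consEven, levelOneWeight_cons]
    linarith

end Poincare

/-! ### Rademacher averages -/

section Rademacher

variable {n : ℕ} {X : Type*} [NormedAddCommGroup X]

/-- The sum of the vectors `x i` with signs `ε i`. -/
def signSum (x : Fin n → X) (ε : Fin n → ℤˣ) : X := ∑ i, (ε i : ℤ) • x i

/-- The Rademacher average `𝔼 ‖∑ ε_i x_i‖`. -/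
def radMean (x : Fin n → X) : ℝ := signMean fun ε => ‖signSum x ε‖

lemma radMean_nonneg (x : Fin n → X) : 0 ≤ radMean x := signMean_nonneg fun _ => norm_nonneg _

lemma signSum_neg (x : Fin n → X) (ε : Fin n → ℤˣ) : signSum x (-ε) = -signSum x ε := by
  simp [signSum]

lemma signSum_add (x y : Fin n → X) (ε : Fin n → ℤˣ) :
    signSum (fun i => x i + y i) ε = signSum x ε + signSum y ε := by
  simp [signSum, Finset.sum_add_distrib]

lemma norm_sign_smul (s : ℤˣ) (x : X) : ‖(s : ℤ) • x‖ = ‖x‖ := by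
  rcases Int.units_eq_one_or s with rfl | rfl <;> simp

lemma norm_signSum_le (x : Fin n → X) (ε : Fin n → ℤˣ) : ‖signSum x ε‖ ≤ ∑ i, ‖x i‖ :=
  (norm_sum_le _ _).trans (Finset.sum_le_sum fun _ _ => (norm_sign_smul _ _).le)

lemma radMean_le_sum (x : Fin n → X) : radMean x ≤ ∑ i, ‖x i‖ :=
  (signMean_mono (norm_signSum_le x)).trans (signMean_const _).le

lemma radMean_add_le (x y : Fin n → X) : radMean (fun i => x i + y i) ≤ radMean x + radMean y := by
  unfold radMean
  rw [← signMean_add]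
  refine signMean_mono fun ε => ?_
  rw [signSum_add]
  exact norm_add_le _ _

lemma signSum_sub_flipSign (x : Fin n → X) (ε : Fin n → ℤˣ) (i : Fin n) :
    signSum x ε - signSum x (flipSign i ε) = (2 : ℤ) • (ε i : ℤ) • x i := by
  unfold signSum
  rw [← Finset.sum_sub_distrib, Finset.sum_eq_single i]
  · simp [flipSign, two_smul]
  · intro j _ hj
    simp [flipSign, hj]
  · simp

lemma rademacherNorm_eq (p : ℝ) (x : Fin n → X) :
    rademacherNorm p x = (signMean fun ε => ‖signSum x ε‖ ^ p) ^ (1 / p) := rfl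

lemma radMean_le_rademacherNorm {p : ℝ} (hp : 1 ≤ p) (x : Fin n → X) :
    radMean x ≤ rademacherNorm p x :=
  signMean_le_rpow (fun _ => norm_nonneg _) hp

lemma levelOneWeight_norm_signSum (x : Fin n → X) :
    levelOneWeight (fun ε => ‖signSum x ε‖) = 0 := by
  refine Finset.sum_eq_zero fun i _ => ?_
  have h := signMean_comp_mul_left (-1) fun ε : Fin n → ℤˣ => ((ε i : ℤ) : ℝ) * ‖signSum x ε‖
  have h2 : (fun ε : Fin n → ℤˣ => ((((-1 * ε) i : ℤˣ) : ℤ) : ℝ) * ‖signSum x (-1 * ε)‖) =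
      fun ε => -1 * (((ε i : ℤ) : ℝ) * ‖signSum x ε‖) := by
    ext ε
    rw [neg_one_mul, signSum_neg, norm_neg]
    simp
  rw [h2, signMean_const_mul] at h
  have h3 : signMean (fun ε : Fin n → ℤˣ => ((ε i : ℤ) : ℝ) * ‖signSum x ε‖) = 0 := by linarith
  rw [h3]
  simp

variable [NormedSpace ℝ X]

/-- A signed sum and the one with the sign of `x i` flipped have the same law and differ by
`2 • ε i • x i`. -/
lemma norm_le_radMean (x : Fin n → X) (i : Fin n) : ‖x i‖ ≤ radMean x := by
  have h : 2 * ‖x i‖ ≤ radMean x + radMean x := by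
    nth_rewrite 2 [radMean]
    rw [← signMean_comp_flipSign i, radMean, ← signMean_add, ← signMean_const (n := n) (2 * ‖x i‖)]
    refine signMean_mono fun ε => ?_
    have h2 : ‖(2 : ℤ) • (ε i : ℤ) • x i‖ = 2 * ‖x i‖ := by
      rw [two_zsmul, ← two_smul ℝ, norm_smul, norm_sign_smul]
      simp
    rw [← h2, ← signSum_sub_flipSign]
    exact norm_sub_le _ _
  linarith

lemma sum_signSum_flipSign (x : Fin n → X) (ε : Fin n → ℤˣ) :
    ∑ i, signSum x (flipSign i ε) = ((n : ℝ) - 2) • signSum x ε := by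
  have h : ∀ i, signSum x (flipSign i ε) = signSum x ε - (2 : ℝ) • (ε i : ℤ) • x i := fun i => by
    rw [two_smul ℝ, ← two_zsmul, ← signSum_sub_flipSign]
    abel
  simp only [h, Finset.sum_sub_distrib, ← Finset.smul_sum]
  rw [← signSum, sub_smul]
  simp [← Nat.cast_smul_eq_nsmul ℝ]

/-- By the triangle inequality, the generator of the Dirichlet form maps the norm of a Rademacher
sum to a function that is at most this norm. -/
lemma signEnergy_norm_signSum_le (x : Fin n → X) :
    signEnergy (fun ε => ‖signSum x ε‖) ≤ signMean fun ε => ‖signSum x ε‖ ^ 2 := by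
  set F : (Fin n → ℤˣ) → ℝ := fun ε => ‖signSum x ε‖ with hF
  have h1 : ∀ i, signMean (fun ε => ((F ε - F (flipSign i ε)) / 2) ^ 2) =
      1 / 2 * signMean (fun ε => F ε * (F ε - F (flipSign i ε))) := fun i => by
    have h2 : signMean (fun ε => F (flipSign i ε) ^ 2) = signMean (fun ε => F ε ^ 2) :=
      signMean_comp_flipSign i fun ε => F ε ^ 2
    have h3 : (fun ε => ((F ε - F (flipSign i ε)) / 2) ^ 2) = fun ε =>
        (1 / 2 * (F ε * (F ε - F (flipSign i ε))) - 1 / 4 * F ε ^ 2) +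
          1 / 4 * F (flipSign i ε) ^ 2 := by
      ext ε
      ring
    rw [h3, signMean_add, signMean_sub, signMean_const_mul, signMean_const_mul,
      signMean_const_mul, h2]
    ring
  unfold signEnergy
  simp only [h1]
  rw [← Finset.mul_sum, ← signMean_sum, ← signMean_const_mul]
  refine signMean_mono fun ε => ?_
  have h4 : ((n : ℝ) - 2) * F ε ≤ ∑ i, F (flipSign i ε) := by
    refine le_trans ?_ (norm_sum_le _ _)
    rw [sum_signSum_flipSign, norm_smul]
    exact mul_le_mul_of_nonneg_right (le_abs_self _) (norm_nonneg _)
  have h5 : ∑ i, F ε * (F ε - F (flipSign i ε)) = F ε * (n * F ε - ∑ i, F (flipSign i ε)) := by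
    rw [← Finset.mul_sum, Finset.sum_sub_distrib]
    simp
  rw [h5]
  nlinarith [norm_nonneg (signSum x ε)]

/-- The Kahane inequality between the first and the second moment, with the optimal constant. -/
lemma signMean_sq_le (x : Fin n → X) :
    signMean (fun ε => ‖signSum x ε‖ ^ 2) ≤ 2 * radMean x ^ 2 := by
  have h1 := two_mul_signVariance_le fun ε => ‖signSum x ε‖
  have h2 := signEnergy_norm_signSum_le x
  rw [levelOneWeight_norm_signSum] at h1
  unfold radMean
  linarith

lemma rademacherNorm_le {p : ℝ} (hp : 1 ≤ p) (hp2 : p ≤ 2) (x : Fin n → X) :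
    rademacherNorm p x ≤ 2 * radMean x := by
  rw [rademacherNorm_eq]
  refine (signMean_rpow_le_sq (fun _ => norm_nonneg _) hp hp2).trans ?_
  rw [← Real.sqrt_eq_rpow]
  refine Real.sqrt_le_iff.2 ⟨mul_nonneg zero_le_two (radMean_nonneg x), ?_⟩
  nlinarith [signMean_sq_le x, sq_nonneg (radMean x)]

lemma radMean_smul (c : ℝ) (x : Fin n → X) : radMean (c • x) = |c| * radMean x := by
  have h : ∀ ε, signSum (c • x) ε = c • signSum x ε := by
    intro ε
    simp only [signSum, Finset.smul_sum, Pi.smul_apply]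
    exact Finset.sum_congr rfl fun i _ => smul_comm _ _ _
  simp only [radMean, h, norm_smul, signMean_const_mul, Real.norm_eq_abs]

lemma convexOn_radMean : ConvexOn ℝ Set.univ (radMean : (Fin n → X) → ℝ) := by
  refine ⟨convex_univ, fun x _ y _ a b ha hb _ => ?_⟩
  refine (radMean_add_le (a • x) (b • y)).trans (le_of_eq ?_)
  rw [radMean_smul, radMean_smul, abs_of_nonneg ha, abs_of_nonneg hb, smul_eq_mul, smul_eq_mul]

/-- The contraction principle: the Rademacher average over vectors of a ball is maximal for vectors
on the sphere. -/
lemma exists_radMean_le_of_norm_le [Nontrivial X] {M : ℝ} (hM : 0 ≤ M) (x : Fin n → X)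
    (hx : ∀ i, ‖x i‖ ≤ M) : ∃ y : Fin n → X, (∀ i, ‖y i‖ = M) ∧ radMean x ≤ radMean y := by
  have h1 : x ∈ convexHull ℝ (Set.univ.pi fun _ : Fin n => Metric.sphere (0 : X) M) := by
    refine mem_convexHull_pi fun i _ => ?_
    rw [convexHull_sphere_eq_closedBall _ hM]
    simpa using hx i
  obtain ⟨y, hy, hxy⟩ := convexOn_radMean.exists_ge_of_mem_convexHull (Set.subset_univ _) h1
  exact ⟨y, fun i => by simpa using hy i trivial, hxy⟩

/-- A type inequality for vectors of equal norm holds for vectors of a ball and first moments. -/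
lemma radMean_le_of_equalNorm {p c M : ℝ} (hp : 1 ≤ p)
    (hc : ∀ x : Fin n → X, (∀ i j, ‖x i‖ = ‖x j‖) →
      rademacherNorm p x ≤ c * (∑ i, ‖x i‖ ^ p) ^ (1 / p))
    (hc0 : 0 ≤ c) (hM : 0 ≤ M) (x : Fin n → X) (hx : ∀ i, ‖x i‖ ≤ M) :
    radMean x ≤ c * ((n : ℝ) ^ (1 / p) * M) := by
  rcases subsingleton_or_nontrivial X with hX | hX
  · refine (radMean_le_sum x).trans ?_
    simp only [Subsingleton.elim (x _) 0, norm_zero, Finset.sum_const_zero]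
    positivity
  · obtain ⟨y, hy, hxy⟩ := exists_radMean_le_of_norm_le hM x hx
    refine hxy.trans ((radMean_le_rademacherNorm hp y).trans
      ((hc y fun i j => by rw [hy, hy]).trans (le_of_eq ?_)))
    simp only [hy, Finset.sum_const, Finset.card_univ, Fintype.card_fin, nsmul_eq_mul]
    rw [Real.mul_rpow (by positivity) (by positivity), ← Real.rpow_mul hM,
      mul_one_div_cancel (by linarith), Real.rpow_one]

/-- The set of which the equal norm type constant is the infimum is not empty. -/
lemma exists_equalNormType (p : ℝ) (hp : 1 ≤ p) (hp2 : p ≤ 2) (n : ℕ) (X : Type*)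
    [NormedAddCommGroup X] [NormedSpace ℝ X] :
    ∃ c : ℝ, 0 < c ∧ ∀ x : Fin n → X, (∀ i j, ‖x i‖ = ‖x j‖) →
      rademacherNorm p x ≤ c * (∑ i, ‖x i‖ ^ p) ^ (1 / p) := by
  refine ⟨2 * n + 1, by positivity, fun x hx => ?_⟩
  refine (rademacherNorm_le hp hp2 x).trans ?_
  have hp0 : 0 < p := by linarith
  have h1 : ∀ i, ‖x i‖ ≤ (∑ i, ‖x i‖ ^ p) ^ (1 / p) := fun i => by
    rw [one_div, Real.le_rpow_inv_iff_of_pos (norm_nonneg _) (by positivity) hp0]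
    exact Finset.single_le_sum (f := fun i => ‖x i‖ ^ p) (fun _ _ => by positivity)
      (Finset.mem_univ i)
  have h2 : radMean x ≤ n * (∑ i, ‖x i‖ ^ p) ^ (1 / p) := by
    refine (radMean_le_sum x).trans ((Finset.sum_le_card_nsmul _ _ _ fun i _ => h1 i).trans ?_)
    simp
  have h3 : 0 ≤ (∑ i, ‖x i‖ ^ p) ^ (1 / p) := by positivity
  linarith

end Rademacher

/-! ### Functions that vanish on a grid -/

/-- A function of one variable whose `r`-th derivative is at most `B` and that is at most `δ` at
`2 ^ r` points of distance `≥ h` in an interval of length `K h` is of the order `δ + B h ^ r` on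
this interval. The function is `g 0`, and `g j` is its `j`-th derivative. -/
lemma exists_abs_le_of_abs_le_at_points (r : ℕ) {K : ℝ} (hK : 0 ≤ K) :
    ∃ C : ℝ, 0 ≤ C ∧ ∀ (g : ℕ → ℝ → ℝ) (h δ B a b : ℝ) (t : ℕ → ℝ),
      0 < h → 0 ≤ δ → 0 ≤ B → 0 ≤ a → b ≤ 1 → b - a ≤ K * h →
      (∀ j < r, ∀ s ∈ Set.Icc (0 : ℝ) 1,
        HasDerivWithinAt (g j) (g (j + 1) s) (Set.Icc 0 1) s) →
      (∀ s ∈ Set.Icc a b, |g r s| ≤ B) →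
      (∀ j < 2 ^ r, t j ∈ Set.Icc a b) →
      (∀ j, j + 1 < 2 ^ r → t j + h ≤ t (j + 1)) →
      (∀ j < 2 ^ r, |g 0 (t j)| ≤ δ) →
      ∀ s ∈ Set.Icc a b, |g 0 s| ≤ C * (δ + B * h ^ r) := by
  induction r with
  | zero =>
    refine ⟨1, zero_le_one, fun g h δ B a b t hh hδ hB ha hb hab hg hgr ht hth htδ s hs => ?_⟩
    have := hgr s hs
    simp only [pow_zero]
    linarith
  | succ r ih =>
    obtain ⟨C, hC, ih⟩ := ih
    refine ⟨1 + 2 * (K * C), by positivity,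
      fun g h δ B a b t hh hδ hB ha hb hab hg hgr ht hth htδ s hs => ?_⟩
    have hsub : Set.Icc a b ⊆ Set.Icc (0 : ℝ) 1 := Set.Icc_subset_Icc ha hb
    have hpow : 2 ^ (r + 1) = 2 * 2 ^ r := by ring
    have hd := fun s hs => hg 0 (Nat.succ_pos r) s hs
    -- Between the points with numbers `2 j` and `2 j + 1` the derivative is once at most `2 δ / h`.
    have hξ : ∀ j, ∃ ξ, j < 2 ^ r →
        ξ ∈ Set.Ioo (t (2 * j)) (t (2 * j + 1)) ∧ |g 1 ξ| ≤ 2 * δ / h := by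
      intro j
      by_cases hj : j < 2 ^ r
      swap
      · exact ⟨0, fun hj' => absurd hj' hj⟩
      have h1 := ht (2 * j) (by omega)
      have h2 := ht (2 * j + 1) (by omega)
      have h3 := hth (2 * j) (by omega)
      have hsub2 : Set.Icc (t (2 * j)) (t (2 * j + 1)) ⊆ Set.Icc (0 : ℝ) 1 :=
        (Set.Icc_subset_Icc h1.1 h2.2).trans hsub
      obtain ⟨ξ, hξ, hξ2⟩ := exists_hasDerivAt_eq_slope (g 0) (g 1) (by linarith)
        (fun s hs => ((hd s (hsub2 hs)).continuousWithinAt).mono hsub2)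
        (fun s hs => (hd s (hsub2 (Set.Ioo_subset_Icc_self hs))).hasDerivAt
          (Icc_mem_nhds (by linarith [hs.1, h1.1]) (by linarith [hs.2, h2.2])))
      refine ⟨ξ, fun _ => ⟨hξ, ?_⟩⟩
      have h4 := htδ (2 * j) (by omega)
      have h5 := htδ (2 * j + 1) (by omega)
      have h6 : 0 < t (2 * j + 1) - t (2 * j) := by linarith
      rw [hξ2, abs_div, abs_of_pos h6, div_le_div_iff₀ h6 hh]
      have h7 : |g 0 (t (2 * j + 1)) - g 0 (t (2 * j))| ≤ 2 * δ := by
        refine (abs_sub _ _).trans ?_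
        linarith
      calc _ ≤ 2 * δ * h := by gcongr
        _ ≤ _ := by gcongr; linarith
    choose ξ hξ using hξ
    have hmem : ∀ j < 2 ^ r, ξ j ∈ Set.Icc a b := fun j hj =>
      ⟨(ht (2 * j) (by omega)).1.trans (hξ j hj).1.1.le,
        (hξ j hj).1.2.le.trans (ht (2 * j + 1) (by omega)).2⟩
    have h1 := ih (fun j => g (j + 1)) h (2 * δ / h) B a b ξ hh (by positivity) hB ha hb hab
      (fun j hj => hg (j + 1) (by omega)) hgr hmem
      (fun j hj => by
        have h2 := (hξ j (by omega)).1.2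
        have h3 := (hξ (j + 1) hj).1.1
        have h4 := hth (2 * j + 1) (by omega)
        rw [show 2 * j + 1 + 1 = 2 * (j + 1) by ring] at h4
        linarith)
      (fun j hj => (hξ j hj).2)
    have hpos : 0 < 2 ^ (r + 1) := by positivity
    have h2 := (convex_Icc a b).norm_image_sub_le_of_norm_hasDerivWithin_le
      (fun s hs => (hd s (hsub hs)).mono hsub) h1 (ht 0 hpos) hs
    have h3 : ‖s - t 0‖ ≤ K * h := by
      have := ht 0 hpos
      rw [Real.norm_eq_abs, abs_le]
      constructor <;> linarith [hs.1, hs.2, this.1, this.2]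
    have h4 := htδ 0 hpos
    have h5 : ‖g 0 s - g 0 (t 0)‖ ≤ C * (2 * δ / h + B * h ^ r) * (K * h) :=
      h2.trans (by gcongr)
    have h6 : |g 0 s| ≤ |g 0 (t 0)| + ‖g 0 s - g 0 (t 0)‖ := by
      have := abs_add_le (g 0 (t 0)) (g 0 s - g 0 (t 0))
      rwa [add_sub_cancel] at this
    have h7 : C * (2 * δ / h + B * h ^ r) * (K * h) =
        2 * (K * C) * δ + K * C * (B * h ^ (r + 1)) := by
      field_simp
      ring
    have h8 : 0 ≤ B * h ^ (r + 1) := by positivity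
    have h9 : 0 ≤ K * C * (B * h ^ (r + 1)) := by positivity
    rw [h7] at h5
    calc |g 0 s| ≤ δ + (2 * (K * C) * δ + K * C * (B * h ^ (r + 1))) := by linarith
      _ ≤ _ := by linarith

/-- The vector valued form, obtained from norming functionals, for the equidistant points
`k / L`. -/
lemma exists_norm_le_of_norm_le_at_grid (r : ℕ) :
    ∃ C : ℝ, 0 ≤ C ∧ ∀ (X : Type u) [NormedAddCommGroup X] [NormedSpace ℝ X]
      (g : ℕ → ℝ → X) (δ B : ℝ) (L : ℕ), 0 ≤ δ → 0 ≤ B → 2 ^ r ≤ L →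
      (∀ j < r, ∀ s ∈ Set.Icc (0 : ℝ) 1,
        HasDerivWithinAt (g j) (g (j + 1) s) (Set.Icc 0 1) s) →
      (∀ s ∈ Set.Icc (0 : ℝ) 1, ‖g r s‖ ≤ B) →
      (∀ k < L, ‖g 0 ((k : ℝ) / L)‖ ≤ δ) →
      ∀ s ∈ Set.Icc (0 : ℝ) 1, ‖g 0 s‖ ≤ C * (δ + B / L ^ r) := by
  obtain ⟨C, hC, H⟩ := exists_abs_le_of_abs_le_at_points r (K := 2 ^ r) (by positivity)
  refine ⟨C, hC, fun X _ _ g δ B L hδ hB hL hg hgr ht s hs => ?_⟩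
  obtain ⟨φ, hφ, hφs⟩ := exists_dual_vector'' ℝ (g 0 s)
  have hφle : ∀ x, |φ x| ≤ ‖x‖ := fun x => by
    have := φ.le_opNorm x
    rw [Real.norm_eq_abs] at this
    nlinarith [norm_nonneg x]
  have hL0 : 0 < L := lt_of_lt_of_le (by positivity) hL
  have hLr : (0 : ℝ) < L := by exact_mod_cast hL0
  -- The window of `2 ^ r` consecutive grid points starts at `k / L`.
  obtain ⟨k, hkL, hks, hsk⟩ : ∃ k : ℕ, k + 2 ^ r ≤ L ∧ (k : ℝ) / L ≤ s ∧
      s ≤ ((k + 2 ^ r : ℕ) : ℝ) / L := by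
    have h1 : (⌊s * L⌋₊ : ℝ) ≤ s * L := Nat.floor_le (mul_nonneg hs.1 hLr.le)
    have h2 : s * L < ⌊s * L⌋₊ + 1 := Nat.lt_floor_add_one _
    rcases le_total (⌊s * L⌋₊ + 2 ^ r) L with h | h
    · refine ⟨⌊s * L⌋₊, h, by rwa [div_le_iff₀ hLr], ?_⟩
      rw [le_div_iff₀ hLr]
      push_cast
      have : (1 : ℝ) ≤ 2 ^ r := one_le_pow₀ one_le_two
      linarith
    · refine ⟨L - 2 ^ r, by omega, ?_, ?_⟩
      · rw [div_le_iff₀ hLr]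
        refine le_trans ?_ h1
        exact_mod_cast (by omega : L - 2 ^ r ≤ ⌊s * L⌋₊)
      · rw [Nat.sub_add_cancel hL, div_self hLr.ne']
        exact hs.2
  have h1 := H (fun j s => φ (g j s)) (1 / L) δ B (k / L) ((k + 2 ^ r : ℕ) / L)
    (fun j => ((k + j : ℕ) : ℝ) / L) (by positivity) hδ hB (by positivity)
    (by rw [div_le_one hLr]; exact_mod_cast hkL) (le_of_eq (by push_cast; ring))
    (fun j hj s hs => φ.hasFDerivAt.comp_hasDerivWithinAt s (hg j hj s hs))
    (fun s hs => (hφle _).trans (hgr s ⟨le_trans (by positivity) hs.1, hs.2.trans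
      (by rw [div_le_one hLr]; exact_mod_cast hkL)⟩))
    (fun j hj => ⟨by gcongr; omega, by gcongr⟩)
    (fun j _ => le_of_eq (by push_cast; ring))
    (fun j hj => (hφle _).trans (ht _ (by omega))) s ⟨hks, hsk⟩
  simp only [hφs, RCLike.ofReal_real_eq_id, id, abs_norm] at h1
  refine h1.trans (le_of_eq ?_)
  rw [one_div, inv_pow, div_eq_mul_inv]

section Cube

variable {d : ℕ} {X : Type u} [NormedAddCommGroup X] [NormedSpace ℝ X]

lemma uniqueDiffOn_cube (d : ℕ) : UniqueDiffOn ℝ (cube d) := by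
  unfold cube
  rw [← Set.pi_univ_Icc]
  exact UniqueDiffOn.univ_pi fun i => uniqueDiffOn_Icc zero_lt_one

lemma update_mem_cube {t : Fin d → ℝ} (ht : t ∈ cube d) (i : Fin d) {s : ℝ}
    (hs : s ∈ Set.Icc (0 : ℝ) 1) : Function.update t i s ∈ cube d := by
  unfold cube at *
  constructor <;> intro j <;> by_cases hj : j = i
  · subst hj; simpa using hs.1
  · simpa [hj] using ht.1 j
  · subst hj; simpa using hs.2
  · simpa [hj] using ht.2 j

/-- The `j`-th pure derivative in the direction of the `i`-th coordinate. -/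
def axisDeriv (i : Fin d) (j : ℕ) (f : (Fin d → ℝ) → X) (t : Fin d → ℝ) : X :=
  iteratedFDerivWithin ℝ j f (cube d) t fun _ => Pi.single i 1

lemma partialDeriv_single (i : Fin d) (j : ℕ) (f : (Fin d → ℝ) → X) (t : Fin d → ℝ) :
    partialDeriv (Pi.single i j) f t = axisDeriv i j f t := by
  have h1 : ∀ k, ((finSigmaFinEquiv (n := (Pi.single i j : Fin d → ℕ))).symm k).1 = i := by
    intro k
    by_contra h
    have := ((finSigmaFinEquiv (n := (Pi.single i j : Fin d → ℕ))).symm k).2.2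
    simp [h] at this
  have h2 : ∀ m, m = j → iteratedFDerivWithin ℝ m f (cube d) t (fun _ => Pi.single i 1) =
      axisDeriv i j f t := by
    rintro _ rfl
    rfl
  unfold partialDeriv
  simp only [h1]
  exact h2 _ (by simp)

lemma axisDeriv_zero (i : Fin d) (f : (Fin d → ℝ) → X) (t : Fin d → ℝ) :
    axisDeriv i 0 f t = f t := by
  simp [axisDeriv]

lemma hasDerivWithinAt_axisDeriv {r : ℕ} {f : (Fin d → ℝ) → X}
    (hf : ContDiffOn ℝ r f (cube d)) (i : Fin d) {j : ℕ} (hj : j < r) {t : Fin d → ℝ}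
    (ht : t ∈ cube d) {s : ℝ} (hs : s ∈ Set.Icc (0 : ℝ) 1) :
    HasDerivWithinAt (fun s => axisDeriv i j f (Function.update t i s))
      (axisDeriv i (j + 1) f (Function.update t i s)) (Set.Icc 0 1) s := by
  have h1 := (hf.differentiableOn_iteratedFDerivWithin (m := j) (by exact_mod_cast hj)
    (uniqueDiffOn_cube d) _ (update_mem_cube ht i hs)).hasFDerivWithinAt
  have h2 := h1.comp_hasDerivWithinAt (t := Set.Icc 0 1) s
    (hasDerivAt_update t i s).hasDerivWithinAt fun s hs => update_mem_cube ht i hs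
  have h3 := (ContinuousMultilinearMap.apply ℝ (fun _ : Fin j => Fin d → ℝ) X
    (fun _ => Pi.single i 1)).hasFDerivAt.comp_hasDerivWithinAt s h2
  unfold axisDeriv
  rw [iteratedFDerivWithin_succ_apply_left]
  exact h3

lemma axisDeriv_sub {r : ℕ} {f g : (Fin d → ℝ) → X} (hf : ContDiffOn ℝ r f (cube d))
    (hg : ContDiffOn ℝ r g (cube d)) (i : Fin d) {t : Fin d → ℝ} (ht : t ∈ cube d) :
    axisDeriv i r (fun s => f s - g s) t = axisDeriv i r f t - axisDeriv i r g t := by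
  unfold axisDeriv
  rw [fun_iteratedFDerivWithin_sub_apply (hf t ht) (hg t ht) (uniqueDiffOn_cube d) ht]
  rfl

lemma norm_partialDeriv_le {r : ℕ} {f : (Fin d → ℝ) → X} (hf : f ∈ crBall d r X)
    {α : Fin d → ℕ} (hα : ∑ i, α i ≤ r) {t : Fin d → ℝ} (ht : t ∈ cube d) :
    ‖partialDeriv α f t‖ ≤ 1 := by
  have h : ‖partialDeriv α f t‖ₑ ≤ 1 := le_trans (le_iSup₂_of_le α hα
    (le_iSup₂_of_le (f := fun t _ => ‖partialDeriv α f t‖ₑ) t ht le_rfl)) hf.2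
  rwa [← ofReal_norm, ENNReal.ofReal_le_one] at h

lemma norm_axisDeriv_le {r : ℕ} {f : (Fin d → ℝ) → X} (hf : f ∈ crBall d r X) (i : Fin d)
    {t : Fin d → ℝ} (ht : t ∈ cube d) : ‖axisDeriv i r f t‖ ≤ 1 := by
  rw [← partialDeriv_single]
  exact norm_partialDeriv_le hf (by simp) ht

lemma norm_le_one_of_mem_crBall {r : ℕ} {f : (Fin d → ℝ) → X} (hf : f ∈ crBall d r X)
    {t : Fin d → ℝ} (ht : t ∈ cube d) : ‖f t‖ ≤ 1 := by
  have h := norm_partialDeriv_le hf (α := 0) (by simp) ht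
  have h2 : ∀ m, m = 0 → ∀ v : Fin m → Fin d → ℝ,
      iteratedFDerivWithin ℝ m f (cube d) t v = f t := by
    rintro _ rfl v
    simp
  rwa [partialDeriv, h2 _ (by simp)] at h

/-- The point with number `κ` of the grid with `L` points in each direction. -/
def gridPoint {L : ℕ} (κ : Fin d → Fin L) : Fin d → ℝ := fun i => (κ i : ℝ) / L

lemma gridPoint_mem_cube {L : ℕ} (κ : Fin d → Fin L) : gridPoint κ ∈ cube d := by
  constructor <;> intro i
  · simp only [gridPoint]
    positivity
  · have hL : (0 : ℝ) < L := by exact_mod_cast (κ i).pos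
    simp only [gridPoint]
    rw [Pi.one_apply, div_le_one hL]
    exact_mod_cast (κ i).2.le

variable (d) in
/-- A smooth function that vanishes on a grid is small. The grid is exchanged for the cube in one
coordinate after the other. -/
lemma exists_norm_le_of_vanishing_on_grid (r : ℕ) :
    ∃ C : ℝ, 0 ≤ C ∧ ∀ (X : Type u) [NormedAddCommGroup X] [NormedSpace ℝ X]
      (g : (Fin d → ℝ) → X) (L : ℕ), 2 ^ r ≤ L → ContDiffOn ℝ r g (cube d) →
      (∀ i, ∀ t ∈ cube d, ‖axisDeriv i r g t‖ ≤ 2) →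
      (∀ κ : Fin d → Fin L, g (gridPoint κ) = 0) →
      ∀ t ∈ cube d, ‖g t‖ ≤ C / L ^ r := by
  obtain ⟨C₁, hC₁, H⟩ := exists_norm_le_of_norm_le_at_grid.{u} r
  have key : ∀ S : Finset (Fin d), ∃ C : ℝ, 0 ≤ C ∧
      ∀ (X : Type u) [NormedAddCommGroup X] [NormedSpace ℝ X]
      (g : (Fin d → ℝ) → X) (L : ℕ), 2 ^ r ≤ L → ContDiffOn ℝ r g (cube d) →
      (∀ i, ∀ t ∈ cube d, ‖axisDeriv i r g t‖ ≤ 2) →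
      (∀ κ : Fin d → Fin L, g (gridPoint κ) = 0) →
      ∀ t ∈ cube d, (∀ i ∉ S, ∃ k : Fin L, t i = (k : ℝ) / L) → ‖g t‖ ≤ C / L ^ r := by
    intro S
    induction S using Finset.induction_on with
    | empty =>
      refine ⟨0, le_rfl, fun X _ _ g L hL hg hgr hz t ht hS => ?_⟩
      choose κ hκ using fun i => hS i (Finset.notMem_empty i)
      rw [show t = gridPoint κ from funext hκ, hz, norm_zero, zero_div]
    | insert i S hi ih =>
      obtain ⟨C, hC, ih⟩ := ih
      refine ⟨C₁ * (C + 2), by positivity, fun X _ _ g L hL hg hgr hz t ht hS => ?_⟩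
      have h1 := H X (fun j s => axisDeriv i j g (Function.update t i s)) (C / L ^ r) 2 L
        (by positivity) zero_le_two hL
        (fun j hj s hs => hasDerivWithinAt_axisDeriv hg i hj ht hs)
        (fun s hs => hgr i _ (update_mem_cube ht i hs))
        (fun k hk => by
          rw [axisDeriv_zero]
          have hk' : (0 : ℝ) < L := by exact_mod_cast (Nat.zero_le k).trans_lt hk
          refine ih X g L hL hg hgr hz _ (update_mem_cube ht i ⟨by positivity, ?_⟩) ?_
          · rw [div_le_one hk']
            exact_mod_cast hk.le
          · intro j hj
            by_cases hji : j = i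
            · exact ⟨⟨k, hk⟩, by subst hji; simp⟩
            · obtain ⟨k', hk'⟩ := hS j (by simp [hj, hji])
              exact ⟨k', by simp [hji, hk']⟩)
        (t i) ⟨ht.1 i, ht.2 i⟩
      simp only [axisDeriv_zero, Function.update_eq_self] at h1
      refine h1.trans (le_of_eq ?_)
      ring
  obtain ⟨C, hC, h⟩ := key Finset.univ
  exact ⟨C, hC, fun X _ _ g L hL hg hgr hz t ht =>
    h X g L hL hg hgr hz t ht fun i hi => absurd (Finset.mem_univ i) hi⟩

end Cube

/-! ### The error of the Monte Carlo method -/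

section MonteCarlo

lemma sum_enorm_signSum {X : Type*} [NormedAddCommGroup X] {q : ℕ} (x : Fin q → X) :
    ∑ ε, ‖signSum x ε‖ₑ = 2 ^ q * ENNReal.ofReal (radMean x) := by
  have h : ∑ ε, ‖signSum x ε‖ = 2 ^ q * radMean x := by
    unfold radMean signMean
    field_simp
  simp only [← ofReal_norm]
  rw [← ENNReal.ofReal_sum_of_nonneg fun _ _ => norm_nonneg _, h,
    ENNReal.ofReal_mul (by positivity), ENNReal.ofReal_pow zero_le_two]
  norm_num

variable {T : Type*} [TopologicalSpace T] [SecondCountableTopology T]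
  [MeasurableSpace T] [BorelSpace T] (μ : Measure T) [IsProbabilityMeasure μ]
  {X : Type*} [NormedAddCommGroup X]

/-- Symmetrization: the law of the differences of two independent samples does not change when
some of the pairs are swapped. -/
lemma lintegral_sum_sub_le {q : ℕ} {g : T → X} (hg : Continuous g) {B M : ℝ}
    (hM : ∀ t, ‖g t‖ ≤ M) (hB : ∀ y : Fin q → X, (∀ i, ‖y i‖ ≤ M) → radMean y ≤ B) :
    ∫⁻ ζ : Fin q → T × T, ‖∑ i, (g (ζ i).2 - g (ζ i).1)‖ₑ ∂Measure.pi (fun _ => μ.prod μ) ≤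
      ENNReal.ofReal (2 * B) := by
  set ν : Measure (Fin q → T × T) := Measure.pi (fun _ => μ.prod μ)
  have h1 : ∀ ε : Fin q → ℤˣ, ∫⁻ ζ, ‖∑ i, (g (ζ i).2 - g (ζ i).1)‖ₑ ∂ν =
      ∫⁻ ζ, ‖signSum (fun i => g (ζ i).2 - g (ζ i).1) ε‖ₑ ∂ν := by
    intro ε
    have h2 : MeasurePreserving (fun (ζ : Fin q → T × T) i =>
        (if ε i = 1 then id else Prod.swap : T × T → T × T) (ζ i)) ν ν := by
      refine measurePreserving_pi _ _ fun i => ?_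
      split_ifs
      · exact MeasurePreserving.id _
      · exact Measure.measurePreserving_swap
    rw [← h2.lintegral_comp (f := fun ζ => ‖∑ i, (g (ζ i).2 - g (ζ i).1)‖ₑ)
      (Continuous.measurable (by fun_prop))]
    refine lintegral_congr fun ζ => ?_
    congr 1
    refine Finset.sum_congr rfl fun i _ => ?_
    rcases Int.units_eq_one_or (ε i) with h | h
    · simp [h]
    · simp [h, show (-1 : ℤˣ) ≠ 1 by decide]
  have h3 : (2 : ℝ≥0∞) ^ q * ∫⁻ ζ, ‖∑ i, (g (ζ i).2 - g (ζ i).1)‖ₑ ∂ν ≤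
      2 ^ q * ENNReal.ofReal (2 * B) := by
    calc _ = ∑ ε : Fin q → ℤˣ, ∫⁻ ζ, ‖∑ i, (g (ζ i).2 - g (ζ i).1)‖ₑ ∂ν := by simp
      _ = ∑ ε : Fin q → ℤˣ, ∫⁻ ζ, ‖signSum (fun i => g (ζ i).2 - g (ζ i).1) ε‖ₑ ∂ν :=
        Finset.sum_congr rfl fun ε _ => h1 ε
      _ = ∫⁻ ζ, ∑ ε : Fin q → ℤˣ, ‖signSum (fun i => g (ζ i).2 - g (ζ i).1) ε‖ₑ ∂ν := by
        refine (lintegral_finsetSum _ fun ε _ => Continuous.measurable ?_).symm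
        unfold signSum
        fun_prop
      _ ≤ ∫⁻ ζ, 2 ^ q * ENNReal.ofReal (2 * B) ∂ν := by
        refine lintegral_mono fun ζ => ?_
        rw [sum_enorm_signSum]
        gcongr
        have h4 := radMean_add_le (fun i => g (ζ i).2) (fun i => -g (ζ i).1)
        have h5 := hB (fun i => g (ζ i).2) fun i => hM _
        have h6 := hB (fun i => -g (ζ i).1) fun i => (norm_neg _).trans_le (hM _)
        simp only [← sub_eq_add_neg] at h4
        linarith
      _ = _ := by simp
  rwa [ENNReal.mul_le_mul_iff_right (by simp) (by simp)] at h3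

/-- The error of the Monte Carlo method with `q` samples, in terms of a bound `B` for the Rademacher
averages over the values of the integrand. -/
lemma lintegral_monteCarlo_le [CompactSpace T] [NormedSpace ℝ X] {q : ℕ} (hq : 0 < q)
    {g : T → X} (hg : Continuous g) {B M : ℝ}
    (hM : ∀ t, ‖g t‖ ≤ M) (hB : ∀ y : Fin q → X, (∀ i, ‖y i‖ ≤ M) → radMean y ≤ B)
    [CompleteSpace X] :
    ∫⁻ ω : Fin q → T, ‖∫ t, g t ∂μ - (1 / (q : ℝ)) • ∑ i, g (ω i)‖ₑ ∂Measure.pi (fun _ => μ) ≤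
      ENNReal.ofReal (2 * B / q) := by
  have hq' : (0 : ℝ) < q := by exact_mod_cast hq
  have hint : ∀ {S : Type _} [TopologicalSpace S] [CompactSpace S] [SecondCountableTopology S]
      [MeasurableSpace S] [BorelSpace S] (ρ : Measure S) [IsProbabilityMeasure ρ] (G : S → X),
      Continuous G → Integrable G ρ := fun ρ _ G hG =>
    hG.integrable_of_hasCompactSupport (HasCompactSupport.of_compactSpace G)
  have h1 : ∀ ω : Fin q → T, ∫ t, g t ∂μ - (1 / (q : ℝ)) • ∑ i, g (ω i) =
      (1 / (q : ℝ)) • ∫ ω' : Fin q → T, ∑ i, (g (ω' i) - g (ω i)) ∂Measure.pi (fun _ => μ) := by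
    intro ω
    rw [integral_finsetSum _ fun i _ => hint _ _ (by fun_prop)]
    have h2 : ∀ i : Fin q, ∫ ω' : Fin q → T, (g (ω' i) - g (ω i)) ∂Measure.pi (fun _ => μ) =
        ∫ t, g t ∂μ - g (ω i) := fun i => by
      rw [integral_sub (hint _ _ (by fun_prop)) (hint _ _ (by fun_prop)),
        integral_comp_eval (μ := fun _ : Fin q => μ) hg.aestronglyMeasurable]
      simp
    simp only [h2]
    rw [Finset.sum_sub_distrib, smul_sub]
    simp [← Nat.cast_smul_eq_nsmul ℝ, smul_smul, hq'.ne']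
  have h3 := measurePreserving_arrowProdEquivProdArrow T T (Fin q) (fun _ => μ) (fun _ => μ)
  have hF : Continuous fun p : (Fin q → T) × (Fin q → T) => ‖∑ i, (g (p.2 i) - g (p.1 i))‖ₑ := by
    fun_prop
  have h4 : ∫⁻ ω : Fin q → T, ‖∫ ω' : Fin q → T, ∑ i, (g (ω' i) - g (ω i))
      ∂Measure.pi (fun _ => μ)‖ₑ ∂Measure.pi (fun _ => μ) ≤ ENNReal.ofReal (2 * B) := by
    calc _ ≤ ∫⁻ ω : Fin q → T, ∫⁻ ω' : Fin q → T, ‖∑ i, (g (ω' i) - g (ω i))‖ₑ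
          ∂Measure.pi (fun _ => μ) ∂Measure.pi (fun _ => μ) :=
        lintegral_mono fun ω => enorm_integral_le_lintegral_enorm _
      _ = ∫⁻ p : (Fin q → T) × (Fin q → T), ‖∑ i, (g (p.2 i) - g (p.1 i))‖ₑ
          ∂((Measure.pi fun _ => μ).prod (Measure.pi fun _ => μ)) :=
        (lintegral_prod _ hF.measurable.aemeasurable).symm
      _ = _ := (h3.lintegral_comp hF.measurable).symm
      _ ≤ _ := lintegral_sum_sub_le μ hg hM hB
  simp only [h1, enorm_smul]
  rw [lintegral_const_mul' _ _ enorm_ne_top, Real.enorm_of_nonneg (by positivity),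
    show 2 * B / q = 1 / q * (2 * B) by ring, ENNReal.ofReal_mul (by positivity)]
  gcongr

end MonteCarlo

/-! ### Nonadaptive algorithms -/

lemma zero_mem_cube (d : ℕ) : (0 : Fin d → ℝ) ∈ cube d := by
  simp [cube]

namespace DetAlg

variable {d : ℕ} {X : Type u}

/-- The algorithm that uses `n` fixed nodes and applies `Φ` to the values. It always halts after `n`
values, so the nodes and outputs defined for other numbers of values are irrelevant. -/
def nonadaptive [Zero X] (n : ℕ) (node : Fin n → cube d) (Φ : (Fin n → X) → X) : DetAlg d X where
  next i _ := if h : i < n then node ⟨i, h⟩ else ⟨0, zero_mem_cube d⟩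
  halt i _ := decide (i = n)
  out i v := Φ fun k => if h : (k : ℕ) < i then v ⟨k, h⟩ else 0

variable [Zero X] {n : ℕ} (node : Fin n → cube d) (Φ : (Fin n → X) → X) (f : (Fin d → ℝ) → X)

lemma info_nonadaptive (i : ℕ) (hi : i ≤ n) (j : Fin i) :
    (nonadaptive n node Φ).info f i j = f (node (Fin.castLE hi j)) := by
  induction i with
  | zero => exact j.elim0
  | succ i ih =>
    refine Fin.lastCases ?_ (fun j => ?_) j
    · simp only [info, Fin.snoc_last]
      simp only [nonadaptive]
      rw [dif_pos (by omega)]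
      rfl
    · simp only [info, Fin.snoc_castSucc]
      exact ih (by omega) j

lemma halts_nonadaptive : (nonadaptive n node Φ).Halts f := ⟨n, by simp [nonadaptive]⟩

open Classical in
lemma find_nonadaptive : Nat.find (halts_nonadaptive node Φ f) = n := by
  rw [Nat.find_eq_iff]
  constructor
  · simp [nonadaptive]
  · intro m hm
    simp [nonadaptive, hm.ne]

lemma card_nonadaptive : (nonadaptive n node Φ).card f = n := by
  rw [card, dif_pos (halts_nonadaptive node Φ f), find_nonadaptive]

lemma output_nonadaptive :
    (nonadaptive n node Φ).output f = Φ fun k => f (node k) := by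
  rw [output, dif_pos (halts_nonadaptive node Φ f)]
  have h : ∀ m (hm : m = n), (nonadaptive n node Φ).out m ((nonadaptive n node Φ).info f m) =
      Φ fun k => f (node k) := by
    rintro _ rfl
    simp only [nonadaptive]
    congr 1
    ext k
    rw [dif_pos k.2]
    exact info_nonadaptive node Φ f _ le_rfl k
  exact h _ (find_nonadaptive node Φ f)

end DetAlg

/-! ### Upper bounds for the randomized errors -/

section Upper

variable {d : ℕ} {X : Type u} [NormedAddCommGroup X] [NormedSpace ℝ X]

instance : CompactSpace (cube d) := isCompact_iff_compactSpace.1 isCompact_Icc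

instance : MeasureSpace (cube d) := Measure.Subtype.measureSpace

lemma measurableSet_cube : MeasurableSet (cube d) := measurableSet_Icc

lemma volume_cube : volume (cube d) = 1 := by
  simp [cube, Real.volume_Icc_pi]

instance : IsProbabilityMeasure (volume : Measure (cube d)) :=
  ⟨by rw [Measure.Subtype.volume_univ measurableSet_cube.nullMeasurableSet, volume_cube]⟩

/-- The error bound of the algorithm with output `0` that uses no function values. -/
lemma ranMinError_le_of_norm_le {r : ℕ} (n : ℕ) {M : ℝ}
    (hM : ∀ f ∈ crBall d r X, ∀ t ∈ cube d, ‖f t‖ ≤ M) :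
    ranMinError.{u, v} d r X n ≤ ENNReal.ofReal M := by
  let A : RanAlg.{u, v} d X := ⟨PUnit, ⊤, Measure.dirac PUnit.unit,
    Measure.dirac.isProbabilityMeasure, fun _ => DetAlg.nonadaptive 0 Fin.elim0 fun _ => 0⟩
  have hA : A.Admissible r n := by
    intro f hf
    simp only [A, DetAlg.card_nonadaptive, DetAlg.output_nonadaptive]
    refine ⟨measurable_const, by simp, @measurable_const _ _ (borel X) _ _, ⊥, ?_, by simp⟩
    exact (Set.countable_singleton _).isSeparable
  refine (iInf₂_le A hA).trans (iSup₂_le fun f hf => ?_)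
  simp only [A, DetAlg.output_nonadaptive, sub_zero, lintegral_const, measure_univ, mul_one]
  rw [← ofReal_norm]
  refine ENNReal.ofReal_le_ofReal ((norm_setIntegral_le_of_norm_le_const (by simp [volume_cube])
    fun t ht => hM f hf t ht).trans ?_)
  simp [Measure.real, volume_cube]

variable (X) in
open Classical in
/-- A function in the unit ball of `C^r` with given values on the grid, if there is one. -/
def gridMatch (r L : ℕ) (v : Fin (L ^ d) → X) : (Fin d → ℝ) → X :=
  if h : ∃ g ∈ crBall d r X, ∀ k, g (gridPoint (finFunctionFinEquiv.symm k)) = v k then h.choose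
  else 0

lemma gridMatch_spec {r L : ℕ} {f : (Fin d → ℝ) → X} (hf : f ∈ crBall d r X) :
    gridMatch X r L (fun k => f (gridPoint (finFunctionFinEquiv.symm k))) ∈ crBall d r X ∧
      ∀ κ : Fin d → Fin L, gridMatch X r L (fun k => f (gridPoint (finFunctionFinEquiv.symm k)))
        (gridPoint κ) = f (gridPoint κ) := by
  have h : ∃ g ∈ crBall d r X, ∀ k : Fin (L ^ d), g (gridPoint (finFunctionFinEquiv.symm k)) =
    f (gridPoint (finFunctionFinEquiv.symm k)) := ⟨f, hf, fun _ => rfl⟩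
  unfold gridMatch
  rw [dif_pos h]
  refine ⟨h.choose_spec.1, fun κ => ?_⟩
  have := h.choose_spec.2 (finFunctionFinEquiv κ)
  rwa [Equiv.symm_apply_apply] at this

/-- The integration method with control variate: the grid values determine a function `g` in the
unit ball with the same grid values, and the Monte Carlo method is applied to the difference. -/
def controlVariate (r L q : ℕ) (ω : Fin q → cube d) : DetAlg d X :=
  DetAlg.nonadaptive (L ^ d + q)
    (Fin.append (fun k => ⟨gridPoint (finFunctionFinEquiv.symm k), gridPoint_mem_cube _⟩) ω)
    fun v =>
      let g := gridMatch X r L fun k => v (Fin.castAdd q k)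
      cubeIntegral g + (1 / (q : ℝ)) • ∑ j, (v (Fin.natAdd (L ^ d) j) - g (ω j))

lemma output_controlVariate (r L q : ℕ) (ω : Fin q → cube d) (f : (Fin d → ℝ) → X) :
    (controlVariate r L q ω).output f =
      let g := gridMatch X r L fun k => f (gridPoint (finFunctionFinEquiv.symm k))
      cubeIntegral g + (1 / (q : ℝ)) • ∑ j, (f (ω j) - g (ω j)) := by
  rw [controlVariate, DetAlg.output_nonadaptive]
  simp only [Fin.append_left, Fin.append_right]

lemma card_controlVariate (r L q : ℕ) (ω : Fin q → cube d) (f : (Fin d → ℝ) → X) :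
    (controlVariate r L q ω).card f = ((L ^ d + q : ℕ) : ℕ∞) :=
  DetAlg.card_nonadaptive _ _ _

lemma continuous_restrict_of_mem_crBall {r : ℕ} {f : (Fin d → ℝ) → X} (hf : f ∈ crBall d r X) :
    Continuous fun t : cube d => f t :=
  continuousOn_iff_continuous_domRestrict.1 hf.1.continuousOn

lemma cubeIntegral_eq (f : (Fin d → ℝ) → X) : cubeIntegral f = ∫ t : cube d, f t :=
  (integral_subtype measurableSet_cube f).symm

variable (d) in
/-- The error of the method with `L ^ d` grid points and `q` Monte Carlo samples. -/
lemma exists_ranMinError_le (r : ℕ) : ∃ C : ℝ, 0 ≤ C ∧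
    ∀ (X : Type u) [NormedAddCommGroup X] [NormedSpace ℝ X] [CompleteSpace X] (L q : ℕ) (B : ℝ),
      2 ^ r ≤ L → 0 < q →
      (∀ y : Fin q → X, (∀ i, ‖y i‖ ≤ C / L ^ r) → radMean y ≤ B) →
      ranMinError.{u, v} d r X (L ^ d + q) ≤ ENNReal.ofReal (2 * B / q) := by
  obtain ⟨C, hC, H⟩ := exists_norm_le_of_vanishing_on_grid.{u} d r
  refine ⟨C, hC, fun X _ _ _ L q B hL hq hB => ?_⟩
  let ν : Measure (Fin q → cube d) := Measure.pi fun _ => volume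
  let A : RanAlg.{u, v} d X := ⟨ULift.{v} (Fin q → cube d), inferInstance,
    ν.map MeasurableEquiv.ulift.symm,
    Measure.isProbabilityMeasure_map MeasurableEquiv.ulift.symm.measurable.aemeasurable,
    fun ω => controlVariate r L q ω.down⟩
  have hP : IsProbabilityMeasure (ν.map MeasurableEquiv.ulift.symm : Measure (ULift.{v} _)) :=
    A.isProb
  have hcont : ∀ f ∈ crBall d r X, Continuous fun ω : Fin q → cube d =>
      (controlVariate r L q ω).output f := by
    intro f hf
    have h1 := continuous_restrict_of_mem_crBall hf
    have h2 := continuous_restrict_of_mem_crBall (gridMatch_spec (L := L) hf).1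
    simp only [output_controlVariate]
    exact continuous_const.add (continuous_const.smul (continuous_finsetSum _ fun j _ =>
      (h1.comp (continuous_apply j)).sub (h2.comp (continuous_apply j))))
  have hA : A.Admissible r (L ^ d + q) := by
    intro f hf
    have hcard : ∀ ω, (A.alg ω).card f = ((L ^ d + q : ℕ) : ℕ∞) := fun ω =>
      card_controlVariate r L q ω.down f
    refine ⟨?_, ?_, ?_, ?_⟩
    · simp only [hcard]
      exact measurable_const
    · simp only [hcard]
      rw [lintegral_const]
      simp [A]
    · let := borel X
      have : BorelSpace X := ⟨rfl⟩
      exact (hcont f hf).measurable.comp MeasurableEquiv.ulift.measurable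
    · refine ⟨Submodule.span ℝ (Set.range fun ω => (controlVariate r L q ω).output f),
        (TopologicalSpace.isSeparable_range (hcont f hf)).span, ?_⟩
      exact Filter.Eventually.of_forall fun ω => Submodule.subset_span ⟨ω.down, rfl⟩
  refine (iInf₂_le A hA).trans (iSup₂_le fun f hf => ?_)
  have hmap : ∫⁻ ω, ‖cubeIntegral f - (A.alg ω).output f‖ₑ ∂A.P =
      ∫⁻ ω, ‖cubeIntegral f - (controlVariate r L q ω).output f‖ₑ ∂ν :=
    lintegral_map_equiv _ _
  rw [hmap]
  obtain ⟨hg, hfg⟩ := gridMatch_spec (L := L) hf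
  simp only [output_controlVariate]
  set g := gridMatch X r L fun k => f (gridPoint (finFunctionFinEquiv.symm k)) with hgdef
  have hfc := continuous_restrict_of_mem_crBall hf
  have hgc := continuous_restrict_of_mem_crBall hg
  have hbound : ∀ t : cube d, ‖f t - g t‖ ≤ C / L ^ r := fun t =>
    H X (fun t => f t - g t) L hL (hf.1.sub hg.1)
      (fun i t ht => by
        rw [axisDeriv_sub hf.1 hg.1 i ht]
        refine (norm_sub_le _ _).trans ?_
        linarith [norm_axisDeriv_le hf i ht, norm_axisDeriv_le hg i ht])
      (fun κ => by rw [hfg κ, sub_self]) t t.2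
  have hmain := lintegral_monteCarlo_le volume hq (hfc.sub hgc) hbound hB
  refine le_trans (le_of_eq (lintegral_congr fun ω => ?_)) hmain
  have h3 : ∀ {G : cube d → X}, Continuous G → Integrable G volume := fun hG =>
    hG.integrable_of_hasCompactSupport (HasCompactSupport.of_compactSpace _)
  simp only [Pi.sub_apply]
  rw [integral_sub (h3 hfc) (h3 hgc), cubeIntegral_eq f, cubeIntegral_eq g, sub_add_eq_sub_sub]

end Upper

/-! ### The rate of the upper bound -/

section UpperRate

lemma radMean_append_zero {X : Type*} [NormedAddCommGroup X] {m q : ℕ} (y : Fin q → X) :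
    radMean (Fin.append (fun _ : Fin m => 0) y) = radMean y := by
  have h : ∀ (a : Fin m → ℤˣ) (b : Fin q → ℤˣ),
      signSum (Fin.append (fun _ : Fin m => 0) y) (Fin.append a b) = signSum y b := by
    intro a b
    simp [signSum, Fin.sum_univ_add]
  unfold radMean signMean
  rw [← Equiv.sum_comp (Fin.appendEquiv m q), Fintype.sum_prod_type]
  simp only [Fin.appendEquiv, Equiv.coe_fn_mk, h]
  simp [pow_add, mul_div_mul_left]

lemma exists_grid_size {d : ℕ} (hd : 1 ≤ d) {m n : ℕ} (h : 2 * m ^ d ≤ n) :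
    ∃ L, m ≤ L ∧ 2 * L ^ d ≤ n ∧ n < 2 * (L + 1) ^ d := by
  have hself : ∀ k : ℕ, k ≤ k ^ d := fun k => Nat.le_self_pow (by omega) k
  refine ⟨Nat.findGreatest (fun L => 2 * L ^ d ≤ n) n, Nat.le_findGreatest ?_ h,
    Nat.findGreatest_spec (P := fun L => 2 * L ^ d ≤ n) (m := m) ?_ h, ?_⟩
  · have := hself m
    omega
  · have := hself m
    omega
  · set L := Nat.findGreatest (fun L => 2 * L ^ d ≤ n) n with hL
    rcases le_or_gt (L + 1) n with h1 | h1
    · have := Nat.findGreatest_is_greatest (P := fun L => 2 * L ^ d ≤ n) (n := n)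
        (k := L + 1) (by omega) h1
      omega
    · have := hself (L + 1)
      omega

/-- The upper bound of the randomized errors by any constant in the type inequality. -/
lemma exists_ranMinError_le_of_type (d r : ℕ) (hd : 1 ≤ d) : ∃ c₁ : ℝ, 0 < c₁ ∧
    ∀ (p : ℝ), 1 ≤ p →
    ∀ (X : Type u) [NormedAddCommGroup X] [NormedSpace ℝ X] [CompleteSpace X] (n : ℕ), 1 ≤ n →
    ∀ c : ℝ, 0 < c → (∀ x : Fin n → X, (∀ i j, ‖x i‖ = ‖x j‖) →
      rademacherNorm p x ≤ c * (∑ i, ‖x i‖ ^ p) ^ (1 / p)) →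
    ENNReal.ofReal (c₁ * (n : ℝ) ^ ((r : ℝ) / (d : ℝ) + 1 - 1 / p)) *
      ranMinError.{u, v} d r X n ≤ ENNReal.ofReal c := by
  obtain ⟨C, hC, H⟩ := exists_ranMinError_le.{u, v} d r
  set n₀ : ℕ := 2 * (2 ^ r) ^ d with hn₀
  have hn₀' : (0 : ℝ) < n₀ := by rw [hn₀]; positivity
  have hd' : (0 : ℝ) < d := by exact_mod_cast hd
  refine ⟨min ((n₀ : ℝ) ^ ((r : ℝ) / d + 1))⁻¹ (4 * 4 ^ r * C + 1)⁻¹,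
    lt_min (by positivity) (by positivity), fun p hp X _ _ _ n hn c hc hcX => ?_⟩
  set c₁ : ℝ := min ((n₀ : ℝ) ^ ((r : ℝ) / d + 1))⁻¹ (4 * 4 ^ r * C + 1)⁻¹ with hc₁
  have hc₁0 : 0 ≤ c₁ := le_min (by positivity) (by positivity)
  have hn' : (0 : ℝ) < n := by exact_mod_cast hn
  have hexp : (n : ℝ) ^ ((r : ℝ) / d + 1 - 1 / p) =
      (n : ℝ) ^ ((r : ℝ) / d + 1) / (n : ℝ) ^ (1 / p) := Real.rpow_sub hn' _ _
  have hnp : 0 < (n : ℝ) ^ (1 / p) := by positivity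
  rcases lt_or_ge n n₀ with hlt | hge
  · rcases subsingleton_or_nontrivial X with hX | hX
    · have : ranMinError.{u, v} d r X n ≤ ENNReal.ofReal 0 :=
        ranMinError_le_of_norm_le n fun f _ t _ => by simp [Subsingleton.elim (f t) 0]
      rw [ENNReal.ofReal_zero, nonpos_iff_eq_zero] at this
      simp [this]
    · have h1 : ranMinError.{u, v} d r X n ≤ ENNReal.ofReal 1 :=
        ranMinError_le_of_norm_le n fun f hf t ht => norm_le_one_of_mem_crBall hf ht
      -- For small `n` it is enough that the type constants are at least `n ^ (-1 / p)`.
      obtain ⟨x, hx⟩ := exists_norm_eq X zero_le_one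
      have h2 := radMean_le_of_equalNorm hp hcX hc.le zero_le_one (fun _ => x) fun _ => hx.le
      have h3 := norm_le_radMean (fun _ : Fin n => x) ⟨0, hn⟩
      rw [mul_one] at h2
      rw [ENNReal.ofReal_one] at h1
      refine (mul_le_of_le_one_right' h1).trans (ENNReal.ofReal_le_ofReal ?_)
      have h4 : c₁ * (n : ℝ) ^ ((r : ℝ) / d + 1) ≤ 1 := by
        calc _ ≤ ((n₀ : ℝ) ^ ((r : ℝ) / d + 1))⁻¹ * (n₀ : ℝ) ^ ((r : ℝ) / d + 1) := by
              gcongr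
              exact min_le_left _ _
          _ = 1 := inv_mul_cancel₀ (by positivity)
      rw [hexp, ← mul_div_assoc, div_le_iff₀ hnp]
      linarith
  · obtain ⟨L, hL, hLn, hnL⟩ := exists_grid_size hd hge
    obtain ⟨q, rfl⟩ : ∃ q, n = L ^ d + q := ⟨n - L ^ d, by omega⟩
    have hL0 : 0 < L := lt_of_lt_of_le (by positivity) hL
    have hLr : (0 : ℝ) < L := by exact_mod_cast hL0
    have hLd : 0 < L ^ d := by positivity
    have hq : 0 < q := by omega
    have hqr : (0 : ℝ) < q := by exact_mod_cast hq
    set n := L ^ d + q with hn_def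
    have h1 := H X L q (c * ((n : ℝ) ^ (1 / p) * (C / L ^ r))) hL hq fun y hy => by
      rw [← radMean_append_zero (m := L ^ d) y]
      refine radMean_le_of_equalNorm hp hcX hc.le (by positivity) _ fun i => ?_
      refine Fin.addCases (fun i => ?_) (fun i => ?_) i
      · rw [Fin.append_left, norm_zero]
        positivity
      · rw [Fin.append_right]
        exact hy i
    refine (mul_le_mul_right h1 _).trans ?_
    rw [← ENNReal.ofReal_mul (by positivity)]
    refine ENNReal.ofReal_le_ofReal ?_
    have h2 : (n : ℝ) ^ ((r : ℝ) / d) ≤ 4 ^ r * L ^ r := by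
      have h3 : n ≤ (4 * L) ^ d := by
        calc n ≤ 2 * (L + 1) ^ d := hnL.le
          _ ≤ 2 ^ d * (2 * L) ^ d := by
            gcongr
            · exact Nat.le_self_pow (by omega) 2
            · omega
          _ = (4 * L) ^ d := by rw [← mul_pow]; ring
      have h4 : (n : ℝ) ≤ (4 * L) ^ d := by exact_mod_cast h3
      calc (n : ℝ) ^ ((r : ℝ) / d) ≤ ((4 * L : ℝ) ^ d) ^ ((r : ℝ) / d) := by gcongr
        _ = 4 ^ r * L ^ r := by
          rw [← Real.rpow_natCast, ← Real.rpow_mul (by positivity), mul_div_cancel₀ _ hd'.ne',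
            Real.rpow_natCast, mul_pow]
    have h5 : (n : ℝ) ≤ 2 * q := by exact_mod_cast (by omega : n ≤ 2 * q)
    have h6 : (n : ℝ) ^ ((r : ℝ) / d + 1) ≤ 4 ^ r * L ^ r * (2 * q) := by
      rw [Real.rpow_add hn', Real.rpow_one]
      gcongr
    have h7 : c₁ * (4 * 4 ^ r * C) ≤ 1 := by
      calc _ ≤ (4 * 4 ^ r * C + 1)⁻¹ * (4 * 4 ^ r * C + 1) := by
            gcongr
            · exact min_le_right _ _
            · linarith
        _ = 1 := inv_mul_cancel₀ (by positivity)
    calc c₁ * (n : ℝ) ^ ((r : ℝ) / d + 1 - 1 / p) *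
          (2 * (c * ((n : ℝ) ^ (1 / p) * (C / L ^ r))) / q) =
        c₁ * (n : ℝ) ^ ((r : ℝ) / d + 1) * (2 * c * C) / (L ^ r * q) := by
          rw [hexp]
          field_simp
      _ ≤ c₁ * (4 ^ r * L ^ r * (2 * q)) * (2 * c * C) / (L ^ r * q) := by gcongr
      _ = c₁ * (4 * 4 ^ r * C) * c := by
        field_simp
        ring
      _ ≤ 1 * c := by gcongr
      _ = c := one_mul c

lemma le_ofReal_sInf {S : Set ℝ} (hS : S.Nonempty) {a : ℝ≥0∞}
    (h : ∀ c ∈ S, a ≤ ENNReal.ofReal c) (h0 : ∀ c ∈ S, 0 < c) : a ≤ ENNReal.ofReal (sInf S) := by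
  obtain ⟨c, hc⟩ := hS
  have ha : a ≠ ⊤ := ne_top_of_le_ne_top ENNReal.ofReal_ne_top (h c hc)
  rw [ENNReal.le_ofReal_iff_toReal_le ha (Real.sInf_nonneg fun c hc => (h0 c hc).le)]
  exact le_csInf ⟨c, hc⟩ fun c hc =>
    (ENNReal.le_ofReal_iff_toReal_le ha (h0 c hc).le).1 (h c hc)

end UpperRate

/-! ### Functions composed of bumps with signs -/

section Bumps

variable (d : ℕ)

/-- A smooth bump function whose support is a compact subset of the open unit cube. -/
def cubeBump : ContDiffBump (fun _ : Fin d => (1 / 2 : ℝ)) :=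
  ⟨1 / 4, 1 / 3, by norm_num, by norm_num⟩

variable {d}

/-- The bump that is shrunk to the cell with number `κ` of the partition into `m ^ d` cells. -/
def cellBump {m : ℕ} (κ : Fin d → Fin m) (t : Fin d → ℝ) : ℝ :=
  cubeBump d ((m : ℝ) • t - fun i => ((κ i : ℕ) : ℝ))

lemma contDiff_cellBump {m : ℕ} (κ : Fin d → Fin m) {k : ℕ∞} : ContDiff ℝ k (cellBump κ) :=
  (cubeBump d).contDiff.comp ((contDiff_const_smul _).sub contDiff_const)

lemma iteratedFDeriv_cellBump {m : ℕ} (κ : Fin d → Fin m) (j : ℕ) (t : Fin d → ℝ) :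
    iteratedFDeriv ℝ j (cellBump κ) t = (m : ℝ) ^ j •
      iteratedFDeriv ℝ j (cubeBump d) ((m : ℝ) • t - fun i => ((κ i : ℕ) : ℝ)) := by
  have h : ContDiff ℝ j fun s => cubeBump d (s - fun i => ((κ i : ℕ) : ℝ)) :=
    (cubeBump d).contDiff.comp (contDiff_id.sub contDiff_const)
  have h2 := congrFun (iteratedFDeriv_comp_const_smul (m : ℝ) h) t
  rw [iteratedFDeriv_comp_sub] at h2
  exact h2

lemma cell_eq_floor {m : ℕ} {κ : Fin d → Fin m} {t : Fin d → ℝ}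
    (h : ((m : ℝ) • t - fun i => ((κ i : ℕ) : ℝ)) ∈ tsupport (cubeBump d)) (i : Fin d) :
    (κ i : ℕ) = ⌊m * t i⌋₊ ∧ (κ i : ℝ) < m * t i := by
  rw [(cubeBump d).tsupport_eq, Metric.mem_closedBall] at h
  have h1 := (dist_le_pi_dist _ _ i).trans h
  simp only [cubeBump, Pi.sub_apply, Pi.smul_apply, smul_eq_mul, Real.dist_eq] at h1
  obtain ⟨h2, h3⟩ := abs_le.1 h1
  have h4 : (κ i : ℝ) < m * t i := by linarith
  have h5 : (0 : ℝ) ≤ (κ i : ℕ) := Nat.cast_nonneg _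
  refine ⟨((Nat.floor_eq_iff (h5.trans h4.le)).2 ⟨h4.le, by linarith⟩).symm, h4⟩

lemma cell_unique {m : ℕ} {κ κ' : Fin d → Fin m} {t : Fin d → ℝ}
    (h : ((m : ℝ) • t - fun i => ((κ i : ℕ) : ℝ)) ∈ tsupport (cubeBump d))
    (h' : ((m : ℝ) • t - fun i => ((κ' i : ℕ) : ℝ)) ∈ tsupport (cubeBump d)) : κ = κ' :=
  funext fun i => Fin.ext ((cell_eq_floor h i).1.trans (cell_eq_floor h' i).1.symm)

lemma mem_cube_of_mem_cell {m : ℕ} {κ : Fin d → Fin m} {t : Fin d → ℝ}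
    (h : ((m : ℝ) • t - fun i => ((κ i : ℕ) : ℝ)) ∈ tsupport (cubeBump d)) : t ∈ cube d := by
  have hm : ∀ i, (0 : ℝ) < m := fun i => by exact_mod_cast (κ i).pos
  have h1 : ∀ i, 0 < m * t i ∧ m * t i < m := fun i => by
    obtain ⟨h1, h2⟩ := cell_eq_floor h i
    have h3 : (0 : ℝ) < m * t i := lt_of_le_of_lt (Nat.cast_nonneg _) h2
    refine ⟨h3, (Nat.floor_lt h3.le).1 ?_⟩
    rw [← h1]
    exact (κ i).2
  constructor <;> intro i
  · exact (pos_of_mul_pos_right (h1 i).1 (hm i).le).le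
  · have := (h1 i).2
    simp only [Pi.one_apply]
    nlinarith [hm i]

lemma integral_cellBump {m : ℕ} (κ : Fin d → Fin m) :
    ∫ t in cube d, cellBump κ t = ((m : ℝ) ^ d)⁻¹ * ∫ t, cubeBump d t := by
  rw [setIntegral_eq_integral_of_forall_compl_eq_zero]
  · have h := Measure.integral_comp_smul (volume : Measure (Fin d → ℝ))
      (fun s => cubeBump d (s - fun i => ((κ i : ℕ) : ℝ))) (m : ℝ)
    rw [integral_sub_right_eq_self (fun s => cubeBump d s)] at h
    simp only [Module.finrank_fin_fun, smul_eq_mul] at h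
    rw [abs_of_nonneg (by positivity)] at h
    exact h
  · intro t ht
    by_contra h
    exact ht (mem_cube_of_mem_cell (subset_tsupport _ h))

variable (d) in
lemma exists_bound_iteratedFDeriv_cubeBump (r : ℕ) : ∃ D : ℝ, 0 < D ∧ ∀ j ≤ r, ∀ t,
    ‖iteratedFDeriv ℝ j (cubeBump d) t‖ ≤ D := by
  have h : ∀ j : ℕ, ∃ D : ℝ, ∀ t, ‖iteratedFDeriv ℝ j (cubeBump d) t‖ ≤ D := fun j =>
    ((cubeBump d).hasCompactSupport.iteratedFDeriv j).exists_bound_of_continuous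
      ((cubeBump d).contDiff.continuous_iteratedFDeriv (m := j) (n := j) le_rfl)
  choose D hD using h
  refine ⟨∑ j ∈ Finset.range (r + 1), |D j| + 1, ?_, fun j hj t => (hD j t).trans ?_⟩
  · have := Finset.sum_nonneg fun j (_ : j ∈ Finset.range (r + 1)) => abs_nonneg (D j)
    linarith
  · have := Finset.single_le_sum (f := fun j => |D j|) (fun j _ => abs_nonneg (D j))
      (Finset.mem_range.2 (Nat.lt_succ_of_le hj))
    linarith [le_abs_self (D j)]

lemma sum_le_of_subsingleton {κ : Type*} (s : Finset κ) (a : κ → ℝ) {b : ℝ} (hb : 0 ≤ b)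
    (h : ∀ i ∈ s, a i ≤ b) (h1 : ∀ i ∈ s, ∀ j ∈ s, a i ≠ 0 → a j ≠ 0 → i = j) :
    ∑ i ∈ s, a i ≤ b := by
  by_cases h2 : ∃ i ∈ s, a i ≠ 0
  · obtain ⟨i, hi, hai⟩ := h2
    rw [Finset.sum_eq_single_of_mem i hi fun j hj hji => by
      by_contra haj
      exact hji (h1 j hj i hi haj hai)]
    exact h i hi
  · push Not at h2
    rw [Finset.sum_eq_zero h2]
    exact hb

variable {X : Type u} [NormedAddCommGroup X] [NormedSpace ℝ X]

/-- The signed combination of bumps in different cells. The bump with number `i` carries the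
vector `ε i • x i`. -/
def bumpSum {n m : ℕ} (s : Finset (Fin n)) (κ : Fin n → Fin d → Fin m) (a : ℝ) (x : Fin n → X)
    (ε : Fin n → ℤˣ) (t : Fin d → ℝ) : X :=
  ∑ i ∈ s, (a * cellBump (κ i) t) • (ε i : ℤ) • x i

lemma contDiff_smul_bump {m : ℕ} (κ : Fin d → Fin m) (a : ℝ) (y : X) {k : ℕ∞} :
    ContDiff ℝ k fun t => (a * cellBump κ t) • y :=
  (contDiff_const.mul (contDiff_cellBump κ)).smul contDiff_const

lemma norm_iteratedFDeriv_smul_bump_le {m : ℕ} (κ : Fin d → Fin m) (a : ℝ) (y : X) (j : ℕ)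
    (t : Fin d → ℝ) : ‖iteratedFDeriv ℝ j (fun t => (a * cellBump κ t) • y) t‖ ≤
      |a| * ‖y‖ * (m ^ j * ‖iteratedFDeriv ℝ j (cubeBump d)
        ((m : ℝ) • t - fun i => ((κ i : ℕ) : ℝ))‖) := by
  have h := (ContinuousLinearMap.toSpanSingleton ℝ (a • y)).norm_iteratedFDeriv_comp_left
    (f := cellBump κ) (x := t) (N := j) (n := j) (contDiff_cellBump κ (k := j)).contDiffAt le_rfl
  rw [iteratedFDeriv_cellBump, norm_smul, ContinuousLinearMap.norm_toSpanSingleton,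
    norm_smul] at h
  convert h using 3
  · ext t
    simp [smul_smul, mul_comm]
  · exact (Real.norm_eq_abs a).symm
  · exact (Real.norm_of_nonneg (by positivity)).symm

lemma contDiff_bumpSum {n m : ℕ} (s : Finset (Fin n)) (κ : Fin n → Fin d → Fin m) (a : ℝ)
    (x : Fin n → X) (ε : Fin n → ℤˣ) {k : ℕ∞} : ContDiff ℝ k (bumpSum s κ a x ε) :=
  ContDiff.sum fun i _ => contDiff_smul_bump (κ i) a _

lemma bumpSum_mem_crBall {n m r : ℕ} (hm : 0 < m) {s : Finset (Fin n)}
    {κ : Fin n → Fin d → Fin m} (hκ : Set.InjOn κ s) {D : ℝ} (hD0 : 0 < D)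
    (hD : ∀ j ≤ r, ∀ t, ‖iteratedFDeriv ℝ j (cubeBump d) t‖ ≤ D) {x : Fin n → X}
    (hx : ∀ i, ‖x i‖ ≤ 1) (ε : Fin n → ℤˣ) :
    bumpSum s κ (1 / (D * m ^ r)) x ε ∈ crBall d r X := by
  have hm' : (1 : ℝ) ≤ m := by exact_mod_cast hm
  refine ⟨(contDiff_bumpSum s κ _ x ε (k := r)).contDiffOn, ?_⟩
  refine iSup₂_le fun α hα => iSup₂_le fun t ht => ?_
  rw [← ofReal_norm, ENNReal.ofReal_le_one]
  refine (ContinuousMultilinearMap.le_opNorm _ _).trans ?_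
  simp only [Pi.norm_single, norm_one, Finset.prod_const_one, mul_one]
  generalize ∑ i, α i = j at hα
  rw [iteratedFDerivWithin_eq_iteratedFDeriv (uniqueDiffOn_cube d)
    (contDiff_bumpSum s κ _ x ε (k := j)).contDiffAt ht]
  unfold bumpSum
  rw [iteratedFDeriv_fun_sum_apply fun i _ => (contDiff_smul_bump (κ i) _ _ (k := j)).contDiffAt]
  refine (norm_sum_le _ _).trans (sum_le_of_subsingleton _ _ zero_le_one (fun i _ => ?_)
    fun i hi i' hi' h h' => ?_)
  · refine (norm_iteratedFDeriv_smul_bump_le _ _ _ _ _).trans ?_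
    rw [norm_sign_smul, abs_of_nonneg (by positivity)]
    calc _ ≤ 1 / (D * m ^ r) * 1 * (m ^ r * D) := by
          gcongr
          · exact hx i
          · exact hD j hα _
      _ = 1 := by field_simp
  · have key : ∀ i, ‖iteratedFDeriv ℝ j (fun t => (1 / (D * m ^ r) * cellBump (κ i) t) •
        (ε i : ℤ) • x i) t‖ ≠ 0 →
        ((m : ℝ) • t - fun k => ((κ i k : ℕ) : ℝ)) ∈ tsupport (cubeBump d) := by
      intro i h
      refine support_iteratedFDeriv_subset (𝕜 := ℝ) j fun h0 => h ?_
      have := norm_iteratedFDeriv_smul_bump_le (κ i) (1 / (D * m ^ r)) ((ε i : ℤ) • x i) j t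
      rw [h0, norm_zero, mul_zero, mul_zero] at this
      exact le_antisymm this (norm_nonneg _)
    exact hκ hi hi' (cell_unique (key i h) (key i' h'))

lemma cubeIntegral_bumpSum {n m : ℕ} {s : Finset (Fin n)} (κ : Fin n → Fin d → Fin m) (a : ℝ)
    {x : Fin n → X} (hx : ∀ i ∉ s, x i = 0) (ε : Fin n → ℤˣ) [CompleteSpace X] :
    cubeIntegral (bumpSum s κ a x ε) =
      (a * (((m : ℝ) ^ d)⁻¹ * ∫ t, cubeBump d t)) • signSum x ε := by
  have hsum : signSum x ε = ∑ i ∈ s, (ε i : ℤ) • x i := by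
    refine (Finset.sum_subset (Finset.subset_univ s) fun i _ hi => ?_).symm
    rw [hx i hi, smul_zero]
  unfold cubeIntegral bumpSum
  rw [integral_finsetSum, hsum, Finset.smul_sum]
  · refine Finset.sum_congr rfl fun i _ => ?_
    rw [integral_smul_const, integral_const_mul, integral_cellBump]
  · intro i _
    exact (contDiff_smul_bump (κ i) a _ (k := 0)).continuous.continuousOn.integrableOn_compact
      isCompact_Icc

end Bumps

/-! ### Information used by an adaptive algorithm -/

namespace DetAlg

variable {d : ℕ} {X : Type u} (A : DetAlg d X)

lemma card_eq_of_halts {f : (Fin d → ℝ) → X} {m : ℕ} (hm : A.halt m (A.info f m) = true)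
    (hm' : ∀ j < m, A.halt j (A.info f j) = false) : A.card f = m := by
  classical
  have h : A.Halts f := ⟨m, hm⟩
  rw [card, dif_pos h, Nat.cast_inj, Nat.find_eq_iff]
  exact ⟨hm, fun j hj => by simp [hm' j hj]⟩

lemma output_eq_of_halts [Zero X] {f : (Fin d → ℝ) → X} {m : ℕ}
    (hm : A.halt m (A.info f m) = true) (hm' : ∀ j < m, A.halt j (A.info f j) = false) :
    A.output f = A.out m (A.info f m) := by
  classical
  have h : A.Halts f := ⟨m, hm⟩
  have h2 : Nat.find h = m := by
    rw [Nat.find_eq_iff]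
    exact ⟨hm, fun j hj => by simp [hm' j hj]⟩
  rw [output, dif_pos h, h2]

lemma exists_of_card_ne_top {f : (Fin d → ℝ) → X} (h : A.card f ≠ ⊤) :
    ∃ m : ℕ, A.halt m (A.info f m) = true ∧ ∀ j < m, A.halt j (A.info f j) = false := by
  classical
  have h1 : A.Halts f := by
    by_contra h1
    exact h (by rw [card, dif_neg h1])
  exact ⟨Nat.find h1, Nat.find_spec h1, fun j hj => by simpa using Nat.find_min h1 hj⟩

variable {n : ℕ}

/-- The numbers of the cells that contain one of the nodes with numbers `< m` used at input `f`,
where `cell t` is the set of (at most one) cells that contain `t`. -/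
def touched (cell : (Fin d → ℝ) → Finset (Fin n)) (f : (Fin d → ℝ) → X) (m : ℕ) :
    Finset (Fin n) :=
  (Finset.range m).biUnion fun j => cell (A.next j (A.info f j))

lemma card_touched_le {cell : (Fin d → ℝ) → Finset (Fin n)} (hcell : ∀ t, (cell t).card ≤ 1)
    (f : (Fin d → ℝ) → X) (m : ℕ) : (A.touched cell f m).card ≤ m := by
  refine Finset.card_biUnion_le.trans ((Finset.sum_le_sum fun j _ => hcell _).trans ?_)
  simp

variable {cell : (Fin d → ℝ) → Finset (Fin n)} {F : (Fin n → ℤˣ) → (Fin d → ℝ) → X}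
  (hF : ∀ t ε ε', (∀ i ∈ cell t, ε i = ε' i) → F ε t = F ε' t)

include hF

/-- The information does not depend on the signs in cells without nodes. -/
lemma info_eq_of_eqOn_touched {ε ε' : Fin n → ℤˣ} {m : ℕ}
    (h : ∀ i ∈ A.touched cell (F ε) m, ε i = ε' i) :
    ∀ j ≤ m, A.info (F ε) j = A.info (F ε') j := by
  intro j hj
  induction j with
  | zero => rfl
  | succ j ih =>
    have ih := ih (by omega)
    simp only [info]
    rw [← ih, hF _ ε ε']
    exact fun i hi => h i (Finset.mem_biUnion.2 ⟨j, Finset.mem_range.2 (by omega), hi⟩)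

lemma touched_eq_of_eqOn_touched {ε ε' : Fin n → ℤˣ} {m : ℕ}
    (h : ∀ i ∈ A.touched cell (F ε) m, ε i = ε' i) :
    A.touched cell (F ε') m = A.touched cell (F ε) m := by
  refine Finset.biUnion_congr rfl fun j hj => ?_
  rw [A.info_eq_of_eqOn_touched hF h j (Finset.mem_range.1 hj).le]

/-- If the algorithm halts on `F ε`, then there is a set of at most `card (F ε)` signs that
determine the output, the cardinality, and the set itself. -/
lemma exists_determining_set [Zero X] (hcell : ∀ t, (cell t).card ≤ 1) :
    ∃ J : (Fin n → ℤˣ) → Finset (Fin n), ∀ ε, A.card (F ε) ≠ ⊤ →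
      ((J ε).card : ℕ∞) ≤ A.card (F ε) ∧ ∀ ε', (∀ i ∈ J ε, ε i = ε' i) →
        A.card (F ε') = A.card (F ε) ∧ J ε' = J ε ∧ A.output (F ε') = A.output (F ε) := by
  refine ⟨fun ε => A.touched cell (F ε) (A.card (F ε)).toNat, fun ε hε => ?_⟩
  obtain ⟨m, hm, hm'⟩ := A.exists_of_card_ne_top hε
  have hc := A.card_eq_of_halts hm hm'
  simp only [hc, ENat.toNat_natCast, Nat.cast_le]
  refine ⟨A.card_touched_le hcell _ _, fun ε' h => ?_⟩
  have hinfo := A.info_eq_of_eqOn_touched hF h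
  have h1 : A.halt m (A.info (F ε') m) = true := by rwa [← hinfo m le_rfl]
  have h2 : ∀ j < m, A.halt j (A.info (F ε') j) = false := fun j hj => by
    rw [← hinfo j hj.le]
    exact hm' j hj
  have hc' := A.card_eq_of_halts h1 h2
  refine ⟨hc', ?_, ?_⟩
  · rw [hc', ENat.toNat_natCast]
    exact A.touched_eq_of_eqOn_touched hF h
  · rw [A.output_eq_of_halts hm hm', A.output_eq_of_halts h1 h2, hinfo m le_rfl]

end DetAlg

/-! ### Lower bounds for algorithms on signed bumps -/

section LowerBound

variable {n : ℕ} {X : Type u} [NormedAddCommGroup X] [NormedSpace ℝ X]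

/-- The family `x` with the vectors outside of `s` replaced by zero. -/
def restrictTo (s : Finset (Fin n)) (x : Fin n → X) (i : Fin n) : X := if i ∈ s then x i else 0

lemma radMean_le_signMean_add (z : Fin n → X) (a : X) :
    radMean z ≤ signMean fun η => ‖signSum z η + a‖ := by
  have h : 2 * radMean z ≤ (signMean fun η => ‖signSum z η + a‖) +
      signMean fun η => ‖signSum z η + a‖ := by
    nth_rewrite 2 [← signMean_comp_mul_left (-1)]
    rw [← signMean_add, radMean, ← signMean_const_mul]
    refine signMean_mono fun η => ?_
    rw [neg_one_mul, signSum_neg]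
    have h1 := norm_sub_le (signSum z η + a) (-signSum z η + a)
    rwa [add_sub_add_right_eq_sub, sub_neg_eq_add, ← two_smul ℝ, norm_smul, Real.norm_two] at h1
  linarith

/-- Suppose that the approximation `out ε` of `signSum x ε` depends on the signs in `J ε` only. Then
the error is on the average at least the Rademacher average over the remaining vectors: the
signs outside of `J ε` may be multiplied by independent signs `η`. -/
lemma sum_radMean_le_sum_error (x : Fin n → X) (G : Finset (Fin n → ℤˣ))
    (J : (Fin n → ℤˣ) → Finset (Fin n)) (out : (Fin n → ℤˣ) → X)
    (hJ : ∀ ε ∈ G, ∀ ε', (∀ i ∈ J ε, ε i = ε' i) → ε' ∈ G ∧ J ε' = J ε ∧ out ε' = out ε) :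
    ∑ ε ∈ G, radMean (restrictTo (J ε)ᶜ x) ≤ ∑ ε ∈ G, ‖signSum x ε - out ε‖ := by
  let T : (Fin n → ℤˣ) → (Fin n → ℤˣ) → Fin n → ℤˣ := fun η ε i =>
    if i ∈ J ε then ε i else ε i * η i
  have hT : ∀ η, ∀ ε ∈ G, T η ε ∈ G ∧ J (T η ε) = J ε ∧ out (T η ε) = out ε := fun η ε hε =>
    hJ ε hε _ fun i hi => by simp [T, hi]
  have hTT : ∀ η, ∀ ε ∈ G, T η (T η ε) = ε := by
    intro η ε hε
    ext i
    have h1 : T η (T η ε) i = if i ∈ J ε then T η ε i else T η ε i * η i := by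
      change (if i ∈ J (T η ε) then T η ε i else T η ε i * η i) = _
      rw [(hT η ε hε).2.1]
    rw [h1]
    by_cases hi : i ∈ J ε <;> simp [T, hi, mul_assoc]
  have h1 : ∀ η, ∑ ε ∈ G, ‖signSum x (T η ε) - out ε‖ = ∑ ε ∈ G, ‖signSum x ε - out ε‖ := by
    intro η
    refine Finset.sum_nbij' (T η) (T η) (fun ε hε => (hT η ε hε).1) (fun ε hε => (hT η ε hε).1)
      (hTT η) (hTT η) fun ε hε => ?_
    rw [(hT η ε hε).2.2]
  have h2 : ∀ ε ∈ G, radMean (restrictTo (J ε)ᶜ x) ≤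
      signMean fun η => ‖signSum x (T η ε) - out ε‖ := by
    intro ε _
    have h3 : ∀ η, signSum x (T η ε) - out ε = signSum (restrictTo (J ε)ᶜ x) (ε * η) +
        (signSum (restrictTo (J ε) x) ε - out ε) := by
      intro η
      rw [← add_sub_assoc]
      congr 1
      unfold signSum
      rw [← Finset.sum_add_distrib]
      refine Finset.sum_congr rfl fun i _ => ?_
      by_cases hi : i ∈ J ε <;> simp [T, restrictTo, hi]
    simp only [h3]
    rw [signMean_comp_mul_left ε fun η => ‖signSum (restrictTo (J ε)ᶜ x) η +
        (signSum (restrictTo (J ε) x) ε - out ε)‖]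
    exact radMean_le_signMean_add _ _
  calc _ ≤ ∑ ε ∈ G, signMean fun η => ‖signSum x (T η ε) - out ε‖ := Finset.sum_le_sum h2
    _ = signMean fun η => ∑ ε ∈ G, ‖signSum x (T η ε) - out ε‖ := (signMean_sum _ _).symm
    _ = _ := by
      simp only [h1]
      exact signMean_const _

variable {d : ℕ}

/-- An algorithm of expected cardinality at most `k` has a realization for which the mean error and
the mean cardinality over the inputs `F ε` are at most twice the bounds in expectation. -/
lemma exists_realization {r k : ℕ} (hk : 0 < k) {A : RanAlg.{u, v} d X} (hA : A.Admissible r k)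
    {E : ℝ} (hE : 0 < E) (hAE : A.error r ≤ ENNReal.ofReal E)
    {F : (Fin n → ℤˣ) → (Fin d → ℝ) → X} (hF : ∀ ε, F ε ∈ crBall d r X) :
    ∃ ω, ∑ ε, ‖cubeIntegral (F ε) - (A.alg ω).output (F ε)‖ ≤ 2 * 2 ^ n * E ∧
      ∑ ε, (((A.alg ω).card (F ε) : ℕ∞) : ℝ≥0∞) ≤ 2 * 2 ^ n * k := by
  let := A.mΩ
  have := A.isProb
  let := borel X
  have : BorelSpace X := ⟨rfl⟩
  have hk0 : (k : ℝ≥0∞) ≠ 0 := by exact_mod_cast hk.ne'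
  have hkt : (k : ℝ≥0∞) ≠ ⊤ := ENNReal.natCast_ne_top k
  have hE0 : ENNReal.ofReal E ≠ 0 := by simpa using hE
  have hEt : ENNReal.ofReal E ≠ ⊤ := ENNReal.ofReal_ne_top
  set err : A.Ω → (Fin n → ℤˣ) → ℝ≥0∞ := fun ω ε =>
    ‖cubeIntegral (F ε) - (A.alg ω).output (F ε)‖ₑ with herr
  set cost : A.Ω → (Fin n → ℤˣ) → ℝ≥0∞ := fun ω ε => (((A.alg ω).card (F ε) : ℕ∞) : ℝ≥0∞)
    with hcost
  have hmerr : ∀ ε, Measurable fun ω => err ω ε := fun ε => by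
    have h1 : Measurable fun y : X => ‖cubeIntegral (F ε) - y‖ₑ :=
      (continuous_const.sub continuous_id).enorm.measurable
    exact h1.comp (hA _ (hF ε)).2.2.1
  have hmcost : ∀ ε, Measurable fun ω => cost ω ε := fun ε =>
    (measurable_of_countable fun c : ℕ∞ => (c : ℝ≥0∞)).comp (hA _ (hF ε)).1
  have hm : ∀ ε, Measurable fun ω => k * err ω ε + ENNReal.ofReal E * cost ω ε :=
    fun ε => ((hmerr ε).const_mul _).add ((hmcost ε).const_mul _)
  obtain ⟨ω, hω⟩ := exists_le_lintegral (μ := A.P)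
    (Finset.measurable_fun_sum Finset.univ fun ε _ => hm ε).aemeasurable
  have h1 : ∑ ε, (k * err ω ε + ENNReal.ofReal E * cost ω ε) ≤
      2 * 2 ^ n * (k * ENNReal.ofReal E) := by
    refine hω.trans ?_
    rw [lintegral_finsetSum _ fun ε _ => hm ε]
    calc _ ≤ ∑ ε : Fin n → ℤˣ, 2 * (k * ENNReal.ofReal E) := by
          refine Finset.sum_le_sum fun ε _ => ?_
          rw [lintegral_add_left ((hmerr ε).const_mul _), lintegral_const_mul _ (hmerr ε),
            lintegral_const_mul _ (hmcost ε), two_mul]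
          have h2 : ∫⁻ ω, err ω ε ∂A.P ≤ ENNReal.ofReal E :=
            (le_iSup₂ (f := fun f (_ : f ∈ crBall d r X) =>
              ∫⁻ ω, ‖cubeIntegral f - (A.alg ω).output f‖ₑ ∂A.P) (F ε) (hF ε)).trans hAE
          have h3 : ∫⁻ ω, cost ω ε ∂A.P ≤ k := (hA _ (hF ε)).2.1
          refine add_le_add (by gcongr) ?_
          rw [mul_comm (k : ℝ≥0∞)]
          gcongr
      _ = 2 * 2 ^ n * (k * ENNReal.ofReal E) := by
        simp
        ring
  rw [Finset.sum_add_distrib, ← Finset.mul_sum, ← Finset.mul_sum] at h1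
  refine ⟨ω, ?_, ?_⟩
  · have h2 : k * ∑ ε, err ω ε ≤ k * (2 * 2 ^ n * ENNReal.ofReal E) :=
      (le_self_add.trans h1).trans (le_of_eq (by ring))
    rw [ENNReal.mul_le_mul_iff_right hk0 hkt] at h2
    simp only [herr, ← ofReal_norm] at h2
    rw [← ENNReal.ofReal_sum_of_nonneg fun _ _ => norm_nonneg _] at h2
    rw [← ENNReal.ofReal_le_ofReal_iff (by positivity)]
    refine h2.trans (le_of_eq ?_)
    rw [ENNReal.ofReal_mul (by positivity), ENNReal.ofReal_mul (by positivity),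
      ENNReal.ofReal_pow (by positivity)]
    simp
  · have h2 : ENNReal.ofReal E * ∑ ε, cost ω ε ≤ ENNReal.ofReal E * (2 * 2 ^ n * k) :=
      (le_add_self.trans h1).trans (le_of_eq (by ring))
    rwa [ENNReal.mul_le_mul_iff_right hE0 hEt] at h2

/-- If the integrals of the inputs `F ε` are the multiples by `κ` of signed sums, an algorithm of
expected cardinality `k` and error at most `E` yields a set `J` of at most `4 k` indices such that
the Rademacher average over the remaining vectors is at most `4 E / κ`. -/
lemma exists_radMean_le_of_error_le {r k : ℕ} (hk : 0 < k) {A : RanAlg.{u, v} d X}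
    (hA : A.Admissible r k) {E : ℝ} (hE : 0 < E) (hAE : A.error r ≤ ENNReal.ofReal E)
    {F : (Fin n → ℤˣ) → (Fin d → ℝ) → X} (hF : ∀ ε, F ε ∈ crBall d r X)
    {cell : (Fin d → ℝ) → Finset (Fin n)} (hcell : ∀ t, (cell t).card ≤ 1)
    (hloc : ∀ t ε ε', (∀ i ∈ cell t, ε i = ε' i) → F ε t = F ε' t)
    {κ : ℝ} (hκ : 0 < κ) {x : Fin n → X} (hint : ∀ ε, cubeIntegral (F ε) = κ • signSum x ε) :
    ∃ J : Finset (Fin n), J.card ≤ 4 * k ∧ radMean (restrictTo Jᶜ x) ≤ 4 * E / κ := by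
  classical
  obtain ⟨ω, herr, hcost⟩ := exists_realization hk hA hE hAE hF
  obtain ⟨J, hJ⟩ := (A.alg ω).exists_determining_set hloc hcell
  set G : Finset (Fin n → ℤˣ) := Finset.univ.filter fun ε =>
    (A.alg ω).card (F ε) < ((4 * k : ℕ) : ℕ∞) with hG
  have hcardG : 2 ^ n ≤ 2 * G.card := by
    have h1 : ((Gᶜ.card * (4 * k) : ℕ) : ℝ≥0∞) ≤ ((2 * 2 ^ n * k : ℕ) : ℝ≥0∞) := by
      push_cast
      refine le_trans ?_ hcost
      refine le_trans ?_ (Finset.sum_le_sum_of_subset (Finset.subset_univ Gᶜ))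
      rw [← nsmul_eq_mul]
      refine Finset.card_nsmul_le_sum _ _ _ fun ε hε => ?_
      have h2 : ((4 * k : ℕ) : ℕ∞) ≤ (A.alg ω).card (F ε) := by
        simpa [hG] using hε
      have h3 := ENat.toENNReal_le.2 h2
      simpa using h3
    have h2 : Gᶜ.card * (4 * k) ≤ 2 * 2 ^ n * k := by exact_mod_cast h1
    have h3 : Gᶜ.card * 4 ≤ 2 * 2 ^ n := by
      refine Nat.le_of_mul_le_mul_right ?_ hk
      linarith
    have h4 : G.card + Gᶜ.card = 2 ^ n := by
      rw [Finset.card_add_card_compl]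
      simp
    omega
  have hGne : G.Nonempty := by
    rw [← Finset.card_pos]
    have : 0 < 2 ^ n := by positivity
    omega
  have hfin : ∀ ε ∈ G, (A.alg ω).card (F ε) ≠ ⊤ := fun ε hε =>
    ((Finset.mem_filter.1 hε).2.trans_le le_top).ne
  have h1 := sum_radMean_le_sum_error x G J (fun ε => κ⁻¹ • (A.alg ω).output (F ε))
    fun ε hε ε' h => by
      obtain ⟨h2, h3, h4⟩ := (hJ ε (hfin ε hε)).2 ε' h
      refine ⟨?_, h3, by rw [h4]⟩
      rw [hG, Finset.mem_filter, h2]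
      exact ⟨Finset.mem_univ _, (Finset.mem_filter.1 hε).2⟩
  have h2 : ∑ ε ∈ G, ‖signSum x ε - κ⁻¹ • (A.alg ω).output (F ε)‖ ≤ 2 * 2 ^ n * E / κ := by
    have h3 : ∀ ε, ‖signSum x ε - κ⁻¹ • (A.alg ω).output (F ε)‖ =
        κ⁻¹ * ‖cubeIntegral (F ε) - (A.alg ω).output (F ε)‖ := fun ε => by
      rw [hint, ← Real.norm_of_nonneg (inv_nonneg.2 hκ.le), ← norm_smul, smul_sub, smul_smul,
        Real.norm_of_nonneg (inv_nonneg.2 hκ.le), inv_mul_cancel₀ hκ.ne', one_smul]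
    simp only [h3]
    rw [← Finset.mul_sum, div_eq_inv_mul]
    gcongr
    exact (Finset.sum_le_sum_of_subset_of_nonneg (Finset.subset_univ G)
      fun _ _ _ => norm_nonneg _).trans herr
  have h3 : ∑ ε ∈ G, radMean (restrictTo (J ε)ᶜ x) ≤ ∑ _ε ∈ G, 4 * E / κ := by
    refine (h1.trans h2).trans ?_
    rw [Finset.sum_const, nsmul_eq_mul]
    have h4 : (2 : ℝ) ^ n ≤ 2 * G.card := by exact_mod_cast hcardG
    calc 2 * 2 ^ n * E / κ ≤ 2 * (2 * G.card) * E / κ := by gcongr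
      _ = _ := by ring
  obtain ⟨ε, hε, h4⟩ := Finset.exists_le_of_sum_le hGne h3
  refine ⟨J ε, ?_, h4⟩
  have h5 := (hJ ε (hfin ε hε)).1.trans (Finset.mem_filter.1 hε).2.le
  exact_mod_cast h5

end LowerBound

/-! ### Lower bounds for the randomized errors -/

section LowerRate

lemma exists_cell_count {d N : ℕ} (hd : 1 ≤ d) (hN : 0 < N) :
    ∃ m : ℕ, 0 < m ∧ N ≤ m ^ d ∧ m ^ d ≤ 2 ^ d * N := by
  classical
  have h : ∃ m, N ≤ m ^ d := ⟨N, Nat.le_self_pow (by omega) N⟩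
  have hm0 : 0 < Nat.find h := by
    rw [Nat.pos_iff_ne_zero]
    intro h0
    have := Nat.find_spec h
    rw [h0, zero_pow (by omega)] at this
    omega
  refine ⟨Nat.find h, hm0, Nat.find_spec h, ?_⟩
  have h1 := Nat.find_min h (m := Nat.find h - 1) (by omega)
  rcases Nat.lt_or_ge 1 (Nat.find h) with h2 | h2
  · calc Nat.find h ^ d ≤ (2 * (Nat.find h - 1)) ^ d := by
          gcongr
          omega
      _ = 2 ^ d * (Nat.find h - 1) ^ d := mul_pow _ _ _
      _ ≤ _ := by
        gcongr
        omega
  · rw [show Nat.find h = 1 by omega, one_pow]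
    exact Nat.mul_pos (by positivity) hN

lemma restrictTo_restrictTo_compl {n : ℕ} {X : Type u} [NormedAddCommGroup X]
    (s J : Finset (Fin n)) (x : Fin n → X) :
    restrictTo Jᶜ (restrictTo s x) = restrictTo (s \ J) x := by
  ext i
  by_cases h1 : i ∈ s <;> by_cases h2 : i ∈ J <;> simp [restrictTo, h1, h2]

/-- At least half of the vectors of a family `s` in the unit ball have a Rademacher average that is
bounded in terms of the `k`-th minimal error, if `s` has at least `8 k` members. -/
lemma exists_subset_radMean_le (d r : ℕ) (hd : 1 ≤ d) : ∃ C : ℝ, 0 < C ∧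
    ∀ (X : Type u) [NormedAddCommGroup X] [NormedSpace ℝ X] [CompleteSpace X] (n k : ℕ)
      (x : Fin n → X) (s : Finset (Fin n)), (∀ i, ‖x i‖ ≤ 1) → 0 < k → 8 * k ≤ s.card →
      ∃ I ⊆ s, s.card ≤ 2 * I.card ∧ ENNReal.ofReal (radMean (restrictTo I x)) ≤
        ENNReal.ofReal (C * (s.card : ℝ) ^ ((r : ℝ) / d + 1)) * ranMinError.{u, v} d r X k := by
  classical
  obtain ⟨D, hD0, hD⟩ := exists_bound_iteratedFDeriv_cubeBump d r
  have hψ : 0 < ∫ t, cubeBump d t := (cubeBump d).integral_pos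
  set Ψ := ∫ t, cubeBump d t
  have hd' : (0 : ℝ) < d := by exact_mod_cast hd
  refine ⟨4 * D / Ψ * (2 ^ d) ^ ((r : ℝ) / d + 1), by positivity,
    fun X _ _ _ n k x s hx hk hks => ?_⟩
  obtain ⟨m, hm, hsm, hms⟩ := exists_cell_count hd (N := s.card) (by omega)
  have hm' : (0 : ℝ) < m := by exact_mod_cast hm
  obtain ⟨e⟩ : Nonempty (s ↪ (Fin d → Fin m)) :=
    Function.Embedding.nonempty_of_card_le (by simpa using hsm)
  let κ : Fin n → Fin d → Fin m := fun i => if h : i ∈ s then e ⟨i, h⟩ else fun _ => ⟨0, hm⟩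
  have hκ : Set.InjOn κ s := by
    intro i hi j hj hij
    have hi : i ∈ s := hi
    have hj : j ∈ s := hj
    simp only [κ, hi, hj, dif_pos] at hij
    exact congrArg Subtype.val (e.injective hij)
  set a : ℝ := 1 / (D * m ^ r)
  set y : Fin n → X := restrictTo s x with hy
  have hy1 : ∀ i, ‖y i‖ ≤ 1 := fun i => by
    by_cases h : i ∈ s <;> simp [hy, restrictTo, h, hx]
  let cell : (Fin d → ℝ) → Finset (Fin n) := fun t => s.filter fun i => cellBump (κ i) t ≠ 0
  have hcell : ∀ t, (cell t).card ≤ 1 := fun t => by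
    rw [Finset.card_le_one]
    intro i hi j hj
    simp only [cell, Finset.mem_filter] at hi hj
    exact hκ hi.1 hj.1 (cell_unique (subset_tsupport _ hi.2) (subset_tsupport _ hj.2))
  have hloc : ∀ t (ε ε' : Fin n → ℤˣ), (∀ i ∈ cell t, ε i = ε' i) →
      bumpSum s κ a y ε t = bumpSum s κ a y ε' t := by
    intro t ε ε' h
    refine Finset.sum_congr rfl fun i hi => ?_
    by_cases h0 : cellBump (κ i) t = 0
    · simp [h0]
    · rw [h i (by simp [cell, hi, h0])]
  set τ : ℝ := a * (((m : ℝ) ^ d)⁻¹ * Ψ) with hτ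
  have hτ0 : 0 < τ := by positivity
  have hint : ∀ ε, cubeIntegral (bumpSum s κ a y ε) = τ • signSum y ε :=
    fun ε => cubeIntegral_bumpSum κ a (fun i hi => by simp [hy, restrictTo, hi]) ε
  -- A set with minimal Rademacher average serves for all algorithms.
  obtain ⟨I, hI, hImin⟩ := Finset.exists_min_image
    (s.powerset.filter fun I => s.card ≤ 2 * I.card) (fun I => radMean (restrictTo I x))
    ⟨s, Finset.mem_filter.2 ⟨Finset.mem_powerset_self s, by omega⟩⟩
  simp only [Finset.mem_filter, Finset.mem_powerset] at hI hImin
  refine ⟨I, hI.1, hI.2, ?_⟩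
  have hbound : ENNReal.ofReal (radMean (restrictTo I x)) ≤
      ENNReal.ofReal (4 / τ) * ranMinError.{u, v} d r X k := by
    have h4 : ENNReal.ofReal (4 / τ) ≠ 0 := by
      rw [Ne, ENNReal.ofReal_eq_zero, not_le]
      positivity
    rw [mul_comm, ← ENNReal.div_le_iff h4 ENNReal.ofReal_ne_top]
    refine le_iInf₂ fun A hA => le_of_forall_gt_imp_ge_of_dense fun b hb => ?_
    rcases eq_or_ne b ⊤ with rfl | hbt
    · exact le_top
    have hb0 : 0 < b.toReal := ENNReal.toReal_pos (pos_of_gt hb).ne' hbt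
    obtain ⟨J, hJ, hJr⟩ := exists_radMean_le_of_error_le hk hA hb0
      (by rw [ENNReal.ofReal_toReal hbt]; exact hb.le)
      (fun ε => bumpSum_mem_crBall hm hκ hD0 hD hy1 ε) hcell hloc hτ0 hint
    rw [hy, restrictTo_restrictTo_compl] at hJr
    have h5 := hImin (s \ J) ⟨Finset.sdiff_subset, by
      have := Finset.le_card_sdiff J s
      omega⟩
    rw [ENNReal.div_le_iff h4 ENNReal.ofReal_ne_top, ← ENNReal.ofReal_toReal hbt,
      ← ENNReal.ofReal_mul hb0.le]
    refine ENNReal.ofReal_le_ofReal ((h5.trans hJr).trans (le_of_eq ?_))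
    ring
  refine hbound.trans ?_
  gcongr
  have h6 : (m : ℝ) ^ r * m ^ d ≤ (2 ^ d) ^ ((r : ℝ) / d + 1) *
      (s.card : ℝ) ^ ((r : ℝ) / d + 1) := by
    have h7 : (m : ℝ) ^ d ≤ 2 ^ d * s.card := by exact_mod_cast hms
    calc (m : ℝ) ^ r * m ^ d = ((m : ℝ) ^ d) ^ ((r : ℝ) / d + 1) := by
          rw [← Real.rpow_natCast _ d, ← Real.rpow_mul hm'.le, mul_add,
            mul_div_cancel₀ _ hd'.ne', mul_one, Real.rpow_add hm', Real.rpow_natCast,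
            Real.rpow_natCast]
      _ ≤ (2 ^ d * s.card : ℝ) ^ ((r : ℝ) / d + 1) := by gcongr
      _ = _ := Real.mul_rpow (by positivity) (by positivity)
  calc 4 / τ = 4 * D / Ψ * ((m : ℝ) ^ r * m ^ d) := by
        rw [hτ]
        simp only [a]
        field_simp
    _ ≤ 4 * D / Ψ * ((2 ^ d) ^ ((r : ℝ) / d + 1) * (s.card : ℝ) ^ ((r : ℝ) / d + 1)) := by gcongr
    _ = _ := by ring

lemma radMean_restrictTo_le {n : ℕ} {X : Type u} [NormedAddCommGroup X] (s : Finset (Fin n))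
    {x : Fin n → X} (hx : ∀ i, ‖x i‖ ≤ 1) : radMean (restrictTo s x) ≤ s.card := by
  refine (radMean_le_sum _).trans ?_
  calc ∑ i, ‖restrictTo s x i‖ ≤ ∑ i, if i ∈ s then (1 : ℝ) else 0 := by
        refine Finset.sum_le_sum fun i _ => ?_
        by_cases h : i ∈ s <;> simp [restrictTo, h, hx]
    _ = s.card := by simp

/-- If each family of `N ≥ 8` vectors has a subfamily of at least half its size with Rademacher
average at most `K N ^ (1 / p)`, then such an estimate holds for the whole family: the sum over the
successive halves is geometric. -/
lemma radMean_le_of_halving {n : ℕ} {X : Type u} [NormedAddCommGroup X] {x : Fin n → X} {p K : ℝ}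
    (hp : 1 ≤ p) (hp2 : p ≤ 2) (hK : 2 ≤ K) (hx : ∀ i, ‖x i‖ ≤ 1)
    (h : ∀ s : Finset (Fin n), 8 ≤ s.card → ∃ I ⊆ s, s.card ≤ 2 * I.card ∧
      radMean (restrictTo I x) ≤ K * (s.card : ℝ) ^ (1 / p)) (s : Finset (Fin n)) :
    radMean (restrictTo s x) ≤ 4 * K * (s.card : ℝ) ^ (1 / p) := by
  have hp0 : 0 < p := by linarith
  induction s using Finset.strongInduction with
  | H s ih =>
    rcases lt_or_ge s.card 8 with hs | hs
    · refine (radMean_restrictTo_le s hx).trans ?_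
      rcases Nat.eq_zero_or_pos s.card with h0 | h0
      · rw [h0, Nat.cast_zero]
        positivity
      · have h1 : (1 : ℝ) ≤ (s.card : ℝ) ^ (1 / p) :=
          Real.one_le_rpow (by exact_mod_cast h0) (by positivity)
        have h2 : (s.card : ℝ) ≤ 8 := by exact_mod_cast hs.le
        nlinarith
    · obtain ⟨I, hIs, hI, hIr⟩ := h s hs
      have hss : s \ I ⊂ s := Finset.sdiff_ssubset hIs (Finset.card_pos.1 (by omega))
      have h1 := ih _ hss
      have h2 : radMean (restrictTo s x) ≤
          radMean (restrictTo I x) + radMean (restrictTo (s \ I) x) := by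
        refine le_trans (le_of_eq ?_) (radMean_add_le _ _)
        congr 1
        ext i
        by_cases hi : i ∈ I
        · simp [restrictTo, hi, hIs hi]
        · simp [restrictTo, hi]
      have hN : (0 : ℝ) < s.card := by exact_mod_cast (by omega : 0 < s.card)
      have h3 : ((s \ I).card : ℝ) ≤ s.card * (1 / 2) := by
        have h4 : 2 * (s \ I).card ≤ s.card := by
          rw [Finset.card_sdiff_of_subset hIs]
          omega
        have h5 : 2 * ((s \ I).card : ℝ) ≤ s.card := by exact_mod_cast h4
        linarith
      have h6 : ((s \ I).card : ℝ) ^ (1 / p) ≤ (s.card : ℝ) ^ (1 / p) * (3 / 4) := by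
        calc ((s \ I).card : ℝ) ^ (1 / p) ≤ (s.card * (1 / 2) : ℝ) ^ (1 / p) := by gcongr
          _ = (s.card : ℝ) ^ (1 / p) * (1 / 2) ^ (1 / p) :=
            Real.mul_rpow hN.le (by norm_num)
          _ ≤ (s.card : ℝ) ^ (1 / p) * (1 / 2) ^ ((1 : ℝ) / 2) := by
            gcongr ?_ * ?_
            exact Real.rpow_le_rpow_of_exponent_ge (by norm_num) (by norm_num)
              (one_div_le_one_div_of_le hp0 hp2)
          _ ≤ _ := by
            gcongr
            rw [← Real.sqrt_eq_rpow, Real.sqrt_le_iff]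
            norm_num
      calc radMean (restrictTo s x) ≤ K * (s.card : ℝ) ^ (1 / p) +
            4 * K * ((s.card : ℝ) ^ (1 / p) * (3 / 4)) := by
              refine h2.trans (add_le_add hIr (h1.trans ?_))
              gcongr
        _ = _ := by ring

/-- The type inequality with a constant given by the randomized errors. -/
lemma exists_rademacherNorm_le (d r : ℕ) (hd : 1 ≤ d) : ∃ c₂ : ℝ, 0 < c₂ ∧
    ∀ (p : ℝ), 1 ≤ p → p ≤ 2 →
    ∀ (X : Type u) [NormedAddCommGroup X] [NormedSpace ℝ X] [CompleteSpace X] (n : ℕ), 1 ≤ n →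
    ∀ A : ℝ, 0 ≤ A → (∀ k ∈ Finset.Icc 1 n,
      ENNReal.ofReal ((k : ℝ) ^ ((r : ℝ) / (d : ℝ) + 1 - 1 / p)) * ranMinError.{u, v} d r X k ≤
        ENNReal.ofReal A) →
    ∀ x : Fin n → X, (∀ i j, ‖x i‖ = ‖x j‖) →
      rademacherNorm p x ≤ c₂ * A * (∑ i, ‖x i‖ ^ p) ^ (1 / p) := by
  obtain ⟨C, hC, H⟩ := exists_subset_radMean_le.{u, v} d r hd
  have hd' : (0 : ℝ) < d := by exact_mod_cast hd
  set b : ℝ := (r : ℝ) / d + 1 with hb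
  have hb1 : 1 ≤ b := by
    have : 0 ≤ (r : ℝ) / d := by positivity
    linarith
  refine ⟨16 * (C * 16 ^ b), by positivity, fun p hp hp2 X _ _ _ n hn A hA hAk x hx => ?_⟩
  have hp0 : 0 < p := by linarith
  have hp1 : 1 / p ≤ 1 := by rw [div_le_one hp0]; exact hp
  have hn' : (0 : ℝ) < n := by exact_mod_cast hn
  set M := ‖x ⟨0, hn⟩‖ with hM
  have hxM : ∀ i, ‖x i‖ = M := fun i => hx _ _
  have hR : (∑ i, ‖x i‖ ^ p) ^ (1 / p) = (n : ℝ) ^ (1 / p) * M := by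
    simp only [hxM, Finset.sum_const, Finset.card_univ, Fintype.card_fin, nsmul_eq_mul]
    rw [Real.mul_rpow (by positivity) (by positivity), ← Real.rpow_mul (norm_nonneg _),
      mul_one_div_cancel hp0.ne', Real.rpow_one]
  rw [hR]
  refine (rademacherNorm_le hp hp2 x).trans ?_
  rcases (norm_nonneg (x ⟨0, hn⟩)).eq_or_lt' with hM0 | hM0
  · have h1 := radMean_le_sum x
    simp only [hxM] at h1
    rw [← hM] at hM0
    rw [hM0] at h1 ⊢
    simp only [Finset.sum_const_zero] at h1
    simp only [mul_zero]
    linarith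
  rw [← hM] at hM0
  have hek : ∀ k ∈ Finset.Icc 1 n, ranMinError.{u, v} d r X k ≤
      ENNReal.ofReal (A / (k : ℝ) ^ (b - 1 / p)) := fun k hk => by
    have hk0 : (0 : ℝ) < k := by exact_mod_cast (Finset.mem_Icc.1 hk).1
    rw [ENNReal.ofReal_div_of_pos (by positivity), ENNReal.le_div_iff_mul_le
      (Or.inl (by rw [Ne, ENNReal.ofReal_eq_zero, not_le]; positivity))
      (Or.inl ENNReal.ofReal_ne_top), mul_comm]
    exact hAk k hk
  set y : Fin n → X := M⁻¹ • x with hy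
  have hy1 : ∀ i, ‖y i‖ = 1 := fun i => by
    rw [hy, Pi.smul_apply, norm_smul, hxM, norm_inv, Real.norm_of_nonneg hM0.le,
      inv_mul_cancel₀ hM0.ne']
  -- Equal vectors show that the error is not too small for `k = 1`.
  have hA1 : 1 ≤ C * 16 ^ b * A := by
    obtain ⟨I, -, hI, hIr⟩ := H X 8 1 (fun _ => y ⟨0, hn⟩) Finset.univ (fun _ => (hy1 _).le)
      one_pos (by simp)
    have h1 := hIr.trans (mul_le_mul_right (hek 1 (Finset.mem_Icc.2 ⟨le_rfl, hn⟩)) _)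
    rw [← ENNReal.ofReal_mul (by positivity), ENNReal.ofReal_le_ofReal_iff (by positivity)] at h1
    simp only [Finset.card_univ, Fintype.card_fin, Nat.cast_one, Real.one_rpow, div_one] at h1 hI
    obtain ⟨i, hi⟩ : I.Nonempty := Finset.card_pos.1 (by omega)
    have h2 := norm_le_radMean (restrictTo I fun _ : Fin 8 => y ⟨0, hn⟩) i
    simp only [restrictTo, hi, if_true, hy1] at h2
    refine (h2.trans h1).trans ?_
    gcongr
    norm_num
  have hhalf : ∀ s : Finset (Fin n), 8 ≤ s.card → ∃ I ⊆ s, s.card ≤ 2 * I.card ∧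
      radMean (restrictTo I y) ≤ 2 * (C * 16 ^ b * A) * (s.card : ℝ) ^ (1 / p) := by
    intro s hs
    have hsn : s.card ≤ n := by simpa using s.card_le_univ
    have hk : 1 ≤ s.card / 8 := by omega
    obtain ⟨I, hIs, hI, hIr⟩ := H X n (s.card / 8) y s (fun i => (hy1 i).le) hk (by omega)
    refine ⟨I, hIs, hI, ?_⟩
    have hk0 : (0 : ℝ) < (s.card / 8 : ℕ) := by exact_mod_cast hk
    have h1 := hIr.trans (mul_le_mul_right (hek (s.card / 8)
      (Finset.mem_Icc.2 ⟨hk, by omega⟩)) _)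
    rw [← ENNReal.ofReal_mul (by positivity), ENNReal.ofReal_le_ofReal_iff (by positivity)] at h1
    have hN : (0 : ℝ) < s.card := by exact_mod_cast (by omega : 0 < s.card)
    have h2 : (s.card : ℝ) ≤ 16 * (s.card / 8 : ℕ) := by
      exact_mod_cast (by omega : s.card ≤ 16 * (s.card / 8))
    have h3 : (s.card : ℝ) ^ (b - 1 / p) ≤ 16 ^ b * ((s.card / 8 : ℕ) : ℝ) ^ (b - 1 / p) := by
      calc (s.card : ℝ) ^ (b - 1 / p) ≤ (16 * (s.card / 8 : ℕ) : ℝ) ^ (b - 1 / p) := by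
            gcongr
            linarith
        _ = 16 ^ (b - 1 / p) * ((s.card / 8 : ℕ) : ℝ) ^ (b - 1 / p) :=
          Real.mul_rpow (by norm_num) hk0.le
        _ ≤ _ := by
          gcongr
          · norm_num
          · have : 0 < 1 / p := by positivity
            linarith
    refine h1.trans ?_
    have h4 : (s.card : ℝ) ^ b = (s.card : ℝ) ^ (b - 1 / p) * (s.card : ℝ) ^ (1 / p) := by
      rw [← Real.rpow_add hN]
      congr 1
      ring
    have h5 : 0 < ((s.card / 8 : ℕ) : ℝ) ^ (b - 1 / p) := by positivity
    calc C * (s.card : ℝ) ^ b * (A / ((s.card / 8 : ℕ) : ℝ) ^ (b - 1 / p)) ≤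
        C * (16 ^ b * ((s.card / 8 : ℕ) : ℝ) ^ (b - 1 / p) * (s.card : ℝ) ^ (1 / p)) *
          (A / ((s.card / 8 : ℕ) : ℝ) ^ (b - 1 / p)) := by
          rw [h4]
          gcongr
      _ = 1 * (C * 16 ^ b * A) * (s.card : ℝ) ^ (1 / p) := by field_simp
      _ ≤ _ := by
        gcongr
        norm_num
  have hmain := radMean_le_of_halving hp hp2 (by linarith) (fun i => (hy1 i).le) hhalf Finset.univ
  have h1 : restrictTo Finset.univ y = y := by
    ext i
    simp [restrictTo]
  rw [h1, hy, radMean_smul, abs_of_nonneg (by positivity), inv_mul_le_iff₀ hM0,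
    Finset.card_univ, Fintype.card_fin] at hmain
  calc 2 * radMean x ≤ 2 * (M * (4 * (2 * (C * 16 ^ b * A)) * (n : ℝ) ^ (1 / p))) := by gcongr
    _ = _ := by ring

end LowerRate

end BanachIntegration

end

theorem theorem2 (d r : ℕ) (hd : 1 ≤ d) :
    ∃ c₁ c₂ : ℝ, 0 < c₁ ∧ 0 < c₂ ∧
      ∀ (p : ℝ), 1 ≤ p → p ≤ 2 →
      ∀ (X : Type u) [NormedAddCommGroup X] [NormedSpace ℝ X] [CompleteSpace X] (n : ℕ), 1 ≤ n →
        ENNReal.ofReal (c₁ * (n : ℝ) ^ ((r : ℝ) / (d : ℝ) + 1 - 1 / p)) *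
            BanachIntegration.ranMinError.{u, v} d r X n ≤
          ENNReal.ofReal (BanachIntegration.equalNormTypeConst p n X) ∧
        ENNReal.ofReal (BanachIntegration.equalNormTypeConst p n X) ≤
          ENNReal.ofReal c₂ * ⨆ k ∈ Finset.Icc 1 n,
            ENNReal.ofReal ((k : ℝ) ^ ((r : ℝ) / (d : ℝ) + 1 - 1 / p)) *
              BanachIntegration.ranMinError.{u, v} d r X k := by
  obtain ⟨c₁, hc₁, h₁⟩ := BanachIntegration.exists_ranMinError_le_of_type.{u, v} d r hd
  obtain ⟨c₂, hc₂, h₂⟩ := BanachIntegration.exists_rademacherNorm_le.{u, v} d r hd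
  refine ⟨c₁, c₂, hc₁, hc₂, fun p hp hp2 X _ _ _ n hn => ⟨?_, ?_⟩⟩
  · refine BanachIntegration.le_ofReal_sInf (BanachIntegration.exists_equalNormType p hp hp2 n X)
      (fun c hc => h₁ p hp X n hn c hc.1 hc.2) fun c hc => hc.1
  · set S := ⨆ k ∈ Finset.Icc 1 n, ENNReal.ofReal ((k : ℝ) ^ ((r : ℝ) / (d : ℝ) + 1 - 1 / p)) *
      BanachIntegration.ranMinError.{u, v} d r X k with hS
    rcases eq_or_ne S ⊤ with hSt | hSt
    · rw [hSt, ENNReal.mul_top (by simpa using hc₂)]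
      exact le_top
    have h3 := h₂ p hp hp2 X n hn S.toReal ENNReal.toReal_nonneg fun k hk => by
      rw [ENNReal.ofReal_toReal hSt]
      exact le_iSup₂ (f := fun k (_ : k ∈ Finset.Icc 1 n) =>
        ENNReal.ofReal ((k : ℝ) ^ ((r : ℝ) / (d : ℝ) + 1 - 1 / p)) *
          BanachIntegration.ranMinError.{u, v} d r X k) k hk
    rw [← ENNReal.ofReal_toReal hSt, ← ENNReal.ofReal_mul hc₂.le]
    refine ENNReal.ofReal_le_ofReal (le_of_forall_pos_le_add fun δ hδ => ?_)
    refine csInf_le ⟨0, fun c hc => hc.1.le⟩ ⟨by positivity, fun x hx => (h3 x hx).trans ?_⟩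
    gcongr
    linarith
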